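/- Let $(\Omega,(\mathcal F_n)_{n\in\mathbb N},\mathbb P)$ denote a filtered probability space, and write $df_n:=f_n-f_{n-1}$ ($n\ge 1$) for a process $f$. All identities and inequalities are understood almost surely. For a Banach space $X$, an operator $T$ is called admissible if it maps $X$-valued martingales $f$ (with respect to $(\mathcal F_n)$) with $f_0=0$ to $[0,\infty)$-valued increasing adapted processes $Tf=(Tf_n)_{n}$ with $Tf_0=0$ such that (i) $T(f+g)_n\le Tf_n+Tg_n$ for all such $f,g$ and all $n$; (ii) $Tf_\tau=T(f^\tau)_\tau$ for every stopping time $\tau:\Omega\to\mathbb N\cup\{\infty\}$, where $f^\tau_n:=f_{\tau\wedge n}$ and, for an increasing process $A$, $A_\infty:=\sup_n A_n$; (iii) $Tf_n\le Tf_{n-1}+\|df_n\|_X$ for all $n\ge1$. When no time index is written, $Tf$ stands for $Tf_\infty\in[0,\infty]$. (a) For all $q\in[1,\infty)$, $r\in(1,\infty)$ and $K\in[0,\infty)$ there is a constant $C<\infty$, depending only on $q,r,K$, with the following property. Let $(\Omega,(\mathcal F_n),\mathbb P)$ be a filtered probability space, $X$ a Banach space, and $T,U$ admissible operators, where $U$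 satisfies in addition $U(-f)=Uf$. Suppose that \[ \mathbb P\{Tf>\lambda\}\le K\lambda^{-r}\|Uf\|_{L^r}^r \] for every $\lambda>0$ and every $X$-valued martingale $f$ with $f_0=0$. Then, for every $X$-valued martingale $f$ with $f_0=0$, \[ \|Tf\|_{L^q}\le C\Bigl(\|Uf\|_{L^q}+\bigl\|\sup_{n\ge1}\|df_n\|_X\bigr\|_{L^q}\Bigr). \] (b) For all $q,r\in[1,\infty)$ there is a constant $C<\infty$, depending only on $q$ and $r$, such that for every filtered probability space and every sequence of real-valued martingales $f_k=(f_{k,n})_{n\in\mathbb N}$, $k\in\mathbb N$, with $f_{k,0}=0$, \[ \Bigl\|\Bigl(\sum_{k}(Mf_k)^r\Bigr)^{1/r}\Bigr\|_{L^q}\le C\,\Bigl\|\Bigl(\sum_{k}(Sf_k)^r\Bigr)^{1/r}\Bigr\|_{L^q}, \] where $Mf_k:=\sup_n|f_{k,n}|$ and $Sf_k:=\bigl(\sum_{n\ge1}|df_{k,n}|^2\bigr)^{1/2}$. All norms may take the value $\infty$. -/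

import Mathlib

open MeasureTheory
open scoped ENNReal NNReal

namespace MartingaleBDG

section

variable {Ω X : Type*} {m0 : MeasurableSpace Ω}

/-- Martingale increments `d f n = f n - f (n - 1)`, with `d f 0 = 0`
(all martingales below start at `0`). -/
def d [AddGroup X] (f : ℕ → Ω → X) : ℕ → Ω → X :=
  fun n ω => f n ω - f (n - 1) ω

/-- A martingale (with values in a Banach space) that starts at `0` almost surely. -/
def IsMartingaleFromZero [NormedAddCommGroup X] [NormedSpace ℝ X] [CompleteSpace X]
    (f : ℕ → Ω → X) (ℱ : Filtration ℕ m0) (μ : Measure Ω) : Prop :=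
  Martingale f ℱ μ ∧ f 0 =ᵐ[μ] 0

/-- The terminal maximal function `M f = sup_n ‖f n‖`, with values in `[0, ∞]`. -/
noncomputable def maximalFn [NormedAddCommGroup X] (f : ℕ → Ω → X) : Ω → ℝ≥0∞ :=
  fun ω => ⨆ n, ‖f n ω‖ₑ

/-- The terminal square function `S f = (∑_n ‖d f n‖ ^ 2) ^ (1/2)`, with values in `[0, ∞]`. -/
noncomputable def squareFn [NormedAddCommGroup X] (f : ℕ → Ω → X) : Ω → ℝ≥0∞ :=
  fun ω => (∑' n, ‖d f n ω‖ₑ ^ (2 : ℝ)) ^ (1 / 2 : ℝ)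

/-- The `ℓ^r` norm, `0 < r < ∞`, of a sequence in `[0, ∞]`. -/
noncomputable def lr (r : ℝ) (a : ℕ → ℝ≥0∞) : ℝ≥0∞ :=
  (∑' k, a k ^ r) ^ (1 / r)

/-- The terminal value `A_∞ = sup_n A_n` of an increasing process `A`. -/
noncomputable def terminal (A : ℕ → Ω → ℝ≥0) : Ω → ℝ≥0∞ :=
  fun ω => ⨆ n, (A n ω : ℝ≥0∞)

/-- The value `A_τ` of an increasing process at a random time `τ ∈ ℕ ∪ {∞}`;
it is the terminal value of `A` where `τ = ∞`. -/
noncomputable def valueAt (A : ℕ → Ω → ℝ≥0) (τ : Ω → WithTop ℕ) : Ω → ℝ≥0∞ :=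
  fun ω => match τ ω with
    | none => terminal A ω
    | some n => (A n ω : ℝ≥0∞)

/-- `T` is a subadditive operator that maps `X`-valued martingales starting at `0` to
`[0, ∞)`-valued increasing adapted processes starting at `0`, is compatible with stopping,
`(T f)_τ = (T (f^τ))_τ`, and grows by at most the size of the increments of the martingale.
All identities and inequalities hold almost surely; nothing is required of `T f` when `f` is not
a martingale starting at `0`. -/
structure IsAdmissible [NormedAddCommGroup X] [NormedSpace ℝ X] [CompleteSpace X]
    (T : (ℕ → Ω → X) → ℕ → Ω → ℝ≥0) (ℱ : Filtration ℕ m0) (μ : Measure Ω) : Prop where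
  adapted : ∀ f, IsMartingaleFromZero f ℱ μ → StronglyAdapted ℱ (T f)
  zero : ∀ f, IsMartingaleFromZero f ℱ μ → T f 0 =ᵐ[μ] 0
  increasing : ∀ f, IsMartingaleFromZero f ℱ μ → ∀ n, T f n ≤ᵐ[μ] T f (n + 1)
  subadditive : ∀ f g, IsMartingaleFromZero f ℱ μ → IsMartingaleFromZero g ℱ μ →
    ∀ n, T (f + g) n ≤ᵐ[μ] T f n + T g n
  stopping : ∀ f, IsMartingaleFromZero f ℱ μ → ∀ τ : Ω → WithTop ℕ, IsStoppingTime ℱ τ →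
    valueAt (T f) τ =ᵐ[μ] valueAt (T (stoppedProcess f τ)) τ
  growth : ∀ f, IsMartingaleFromZero f ℱ μ →
    ∀ n, T f (n + 1) ≤ᵐ[μ] fun ω => T f n ω + ‖d f (n + 1) ω‖₊

/-- `U` is even on the martingales starting at `0`: `U (-f) = U f` almost surely. -/
def IsEven [NormedAddCommGroup X] [NormedSpace ℝ X] [CompleteSpace X]
    (U : (ℕ → Ω → X) → ℕ → Ω → ℝ≥0) (ℱ : Filtration ℕ m0) (μ : Measure Ω) : Prop :=
  ∀ f, IsMartingaleFromZero f ℱ μ → ∀ n, U (-f) n =ᵐ[μ] U f n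

/-- The weak-type bound `ℙ {T f > t} ≤ K t ^ (-r) ‖U f‖_{L^r} ^ r` for all `t > 0` and
all martingales `f` starting at `0`. -/
def WeakTypeBound [NormedAddCommGroup X] [NormedSpace ℝ X] [CompleteSpace X]
    (T U : (ℕ → Ω → X) → ℕ → Ω → ℝ≥0) (ℱ : Filtration ℕ m0) (μ : Measure Ω)
    (r : ℝ) (K : ℝ≥0) : Prop :=
  ∀ f, IsMartingaleFromZero f ℱ μ → ∀ t : ℝ, 0 < t →
    μ {ω | ENNReal.ofReal t < terminal (T f) ω} ≤
      K * ENNReal.ofReal (t ^ (-r)) * eLpNorm (terminal (U f)) (ENNReal.ofReal r) μ ^ r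

end

end MartingaleBDG

/-!
Both inequalities come from a good-λ argument, which needs the increments of the martingale to be
bounded by an adapted process one step ahead; the Davis decomposition reduces the general case to
this one.

*Good-λ.* Let `‖d g (n + 1)‖ ≤ w n` with `w` adapted. Let `σ` be the first time at which `T g`
exceeds `l`, and `ρ` the first time at which `U g` or `w` exceeds `δ l`. The martingale
`h = (g - g^σ)^ρ` satisfies `U h ≤ 4 δ l`, because `U g` overshoots its level by at most the last
increment, which `w` controls, and `U h = 0` off `{T g > l}`, because `h` vanishes up to time `σ`.
In the same way, `T g` does not exceed `(1 + δ) l` at time `σ` if `ρ` is infinite, so that on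
the event `{T g > 2 l}` either `T h > (1 - δ) l` or `ρ` is finite. The weak-type bound for `h` now
gives `good_lambda`. Integration in `l` turns it into a moment inequality
(`lintegral_rpow_le_of_good_lambda`).

*Davis decomposition.* The increments of `f` that exceed twice the maximum of the preceding ones
are, after compensation, the increments of a martingale `davisPart f`. The large increments are
summable with sum at most twice the largest increment, and the dual Doob inequality
(`lintegral_tsum_condLExp_rpow_le`) controls their compensators in `L^q`; so `T` and `U` of this
part are controlled by its total variation. The rest of `f` has increments bounded by those of the
past, and the good-λ inequality applies to it. The outcome is `exists_eLpNorm_terminal_le`, for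
weak-type exponents `r > 0`.

*Burkholder-Davis-Gundy.* For real martingales, `L^2` orthogonality and stopping give the weak-type
bound of exponent `2` of the maximal function by the square function, and extrapolation gives the
scalar inequality in every `L^r`, `1 ≤ r < ∞`. Adding up the `r`-th powers of the scalar
inequalities yields a weak-type bound of exponent `r` in `ℓ^r_N`
(`weakTypeBound_coordFunctional`), and a second extrapolation, now for `ℓ^r_N`-valued martingales,
yields `L^q(ℓ^r_N)` with a constant independent of `N`. As the weak-type exponent `1` is allowed
in the extrapolation, the case `r = 1` needs no separate treatment.
-/

namespace MartingaleBDG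

/-! ### Norms, values at random times, stopped martingales -/

section Basics

variable {Ω X : Type*} {m0 : MeasurableSpace Ω} {μ : Measure Ω} {ℱ : Filtration ℕ m0}

theorem eLpNorm_ofReal_eq {q : ℝ} (hq : 0 < q) (F : Ω → ℝ≥0∞) :
    eLpNorm F (ENNReal.ofReal q) μ = (∫⁻ ω, F ω ^ q ∂μ) ^ (1 / q) := by
  rw [eLpNorm_eq_lintegral_rpow_enorm_toReal (by simpa using hq) ENNReal.ofReal_ne_top,
    ENNReal.toReal_ofReal hq.le]
  simp

theorem eLpNorm_ofReal_rpow {q : ℝ} (hq : 0 < q) (F : Ω → ℝ≥0∞) :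
    eLpNorm F (ENNReal.ofReal q) μ ^ q = ∫⁻ ω, F ω ^ q ∂μ := by
  rw [eLpNorm_ofReal_eq hq, ← ENNReal.rpow_mul, one_div_mul_cancel hq.ne', ENNReal.rpow_one]

theorem valueAt_of_eq_top {A : ℕ → Ω → ℝ≥0} {τ : Ω → WithTop ℕ} {ω : Ω} (h : τ ω = ⊤) :
    valueAt A τ ω = terminal A ω := by
  simp only [valueAt, h]

theorem valueAt_of_eq_coe {A : ℕ → Ω → ℝ≥0} {τ : Ω → WithTop ℕ} {ω : Ω} {n : ℕ}
    (h : τ ω = (n : WithTop ℕ)) : valueAt A τ ω = A n ω := by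
  have h' : τ ω = some n := h
  simp only [valueAt, h']

theorem eq_top_or_eq_coe (t : WithTop ℕ) : t = ⊤ ∨ ∃ n : ℕ, t = (n : WithTop ℕ) := by
  cases t with
  | top => exact Or.inl rfl
  | coe n => exact Or.inr ⟨n, rfl⟩

theorem valueAt_le_terminal (A : ℕ → Ω → ℝ≥0) (τ : Ω → WithTop ℕ) (ω : Ω) :
    valueAt A τ ω ≤ terminal A ω := by
  obtain h | ⟨n, h⟩ := eq_top_or_eq_coe (τ ω)
  · rw [valueAt_of_eq_top h]
  · rw [valueAt_of_eq_coe h]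
    exact le_iSup (fun n => (A n ω : ℝ≥0∞)) n

@[simp]
theorem d_zero [AddGroup X] (f : ℕ → Ω → X) : d f 0 = 0 := by
  ext ω; simp [d]

theorem d_succ [AddGroup X] (f : ℕ → Ω → X) (n : ℕ) (ω : Ω) :
    d f (n + 1) ω = f (n + 1) ω - f n ω := rfl

theorem stoppedProcess_of_le {f : ℕ → Ω → X} {τ : Ω → WithTop ℕ} {n : ℕ} {ω : Ω}
    (h : (n : WithTop ℕ) ≤ τ ω) : stoppedProcess f τ n ω = f n ω :=
  stoppedProcess_eq_of_le h

theorem stoppedProcess_of_eq_coe {f : ℕ → Ω → X} {τ : Ω → WithTop ℕ} {k n : ℕ} {ω : Ω}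
    (h : τ ω = (k : WithTop ℕ)) (hn : k ≤ n) : stoppedProcess f τ n ω = f k ω := by
  have h' : τ ω ≤ WithTop.some n := by rw [h]; exact Nat.cast_le.2 hn
  rw [stoppedProcess_eq_of_ge h', h]
  rfl

theorem d_stoppedProcess [AddCommGroup X] (f : ℕ → Ω → X) (τ : Ω → WithTop ℕ) (n : ℕ) :
    d (stoppedProcess f τ) (n + 1) = {ω | (n : WithTop ℕ) < τ ω}.indicator (d f (n + 1)) := by
  ext ω
  rw [d_succ]
  by_cases h : (n : WithTop ℕ) < τ ω
  · have h' : ((n + 1 : ℕ) : WithTop ℕ) ≤ τ ω := by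
      obtain hk | ⟨k, hk⟩ := eq_top_or_eq_coe (τ ω)
      · rw [hk]; exact le_top
      · rw [hk] at h ⊢
        exact Nat.cast_le.2 (Nat.cast_lt.1 h)
    rw [Set.indicator_of_mem (by exact h), d_succ, stoppedProcess_of_le h',
      stoppedProcess_of_le h.le]
  · rw [Set.indicator_of_notMem (by exact h)]
    obtain hk | ⟨k, hk⟩ := eq_top_or_eq_coe (τ ω)
    · rw [hk] at h; exact absurd (WithTop.coe_lt_top n) h
    · have hkn : k ≤ n := by rw [hk, not_lt] at h; exact Nat.cast_le.1 h
      rw [stoppedProcess_of_eq_coe hk hkn, stoppedProcess_of_eq_coe hk (hkn.trans n.le_succ),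
        sub_self]

variable [NormedAddCommGroup X] [NormedSpace ℝ X] [CompleteSpace X]
  {f g : ℕ → Ω → X}

namespace IsMartingaleFromZero

theorem add (hf : IsMartingaleFromZero f ℱ μ) (hg : IsMartingaleFromZero g ℱ μ) :
    IsMartingaleFromZero (f + g) ℱ μ :=
  ⟨hf.1.add hg.1, by filter_upwards [hf.2, hg.2] with ω h1 h2; simp [h1, h2]⟩

theorem neg (hf : IsMartingaleFromZero f ℱ μ) : IsMartingaleFromZero (-f) ℱ μ :=
  ⟨hf.1.neg, by filter_upwards [hf.2] with ω h1; simp [h1]⟩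

theorem sub (hf : IsMartingaleFromZero f ℱ μ) (hg : IsMartingaleFromZero g ℱ μ) :
    IsMartingaleFromZero (f - g) ℱ μ :=
  ⟨hf.1.sub hg.1, by filter_upwards [hf.2, hg.2] with ω h1 h2; simp [h1, h2]⟩

theorem zero : IsMartingaleFromZero (0 : ℕ → Ω → X) ℱ μ :=
  ⟨martingale_zero X ℱ μ, by simp⟩

theorem integrable_d (hf : IsMartingaleFromZero f ℱ μ) (n : ℕ) : Integrable (d f n) μ :=
  (hf.1.integrable n).sub (hf.1.integrable (n - 1))

theorem stronglyMeasurable_d (hf : IsMartingaleFromZero f ℱ μ) (n : ℕ) :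
    StronglyMeasurable[ℱ n] (d f n) :=
  (hf.1.1 n).sub ((hf.1.1 (n - 1)).mono (ℱ.mono (Nat.sub_le n 1)))

theorem condExp_d [IsFiniteMeasure μ] (hf : IsMartingaleFromZero f ℱ μ) (n : ℕ) :
    μ[d f (n + 1) | ℱ n] =ᵐ[μ] 0 := by
  have h1 := condExp_sub (hf.1.integrable (n + 1)) (hf.1.integrable n) (ℱ n)
  have h2 := hf.1.2 n (n + 1) n.le_succ
  have h3 : μ[f n | ℱ n] = f n :=
    condExp_of_stronglyMeasurable (ℱ.le n) (hf.1.1 n) (hf.1.integrable n)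
  filter_upwards [h1, h2] with ω h1 h2
  change (μ[f (n + 1) - f n | ℱ n]) ω = 0
  rw [h1, Pi.sub_apply, h2, h3, sub_self]

theorem stopped [IsFiniteMeasure μ] (hf : IsMartingaleFromZero f ℱ μ) {τ : Ω → WithTop ℕ}
    (hτ : IsStoppingTime ℱ τ) : IsMartingaleFromZero (stoppedProcess f τ) ℱ μ := by
  refine ⟨martingale_of_condExp_sub_eq_zero_nat
    (StronglyAdapted.stoppedProcess_of_discrete hf.1.1 hτ)
    (fun n => integrable_stoppedProcess hτ hf.1.integrable n) fun n => ?_, ?_⟩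
  · have h := d_stoppedProcess f τ n
    change μ[d (stoppedProcess f τ) (n + 1) | ℱ n] =ᵐ[μ] 0
    have hs : MeasurableSet[ℱ n] {ω | (n : WithTop ℕ) < τ ω} := hτ.measurableSet_gt n
    rw [h]
    refine (condExp_indicator (hf.integrable_d (n + 1)) hs).trans ?_
    filter_upwards [hf.condExp_d n] with ω hω
    by_cases h : ω ∈ {ω | (n : WithTop ℕ) < τ ω}
    · rw [Set.indicator_of_mem h, hω]
    · rw [Set.indicator_of_notMem h]; rfl
  · have : stoppedProcess f τ 0 = f 0 := by
      ext ω
      exact stoppedProcess_eq_of_le (by simp)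
    rw [this]
    exact hf.2

end IsMartingaleFromZero

end Basics

/-! ### Admissible operators and the good-λ inequality -/

section Admissible

variable {Ω X : Type*} {m0 : MeasurableSpace Ω} {μ : Measure Ω} {ℱ : Filtration ℕ m0}
  [NormedAddCommGroup X] [NormedSpace ℝ X] [CompleteSpace X]
  {T U : (ℕ → Ω → X) → ℕ → Ω → ℝ≥0} {f g : ℕ → Ω → X}

theorem terminal_le_of_forall_le {A : ℕ → Ω → ℝ≥0} {ω : Ω} {c : ℝ≥0} (h : ∀ n, A n ω ≤ c) :
    terminal A ω ≤ c :=
  iSup_le fun n => ENNReal.coe_le_coe.2 (h n)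

namespace IsAdmissible

theorem measurable_terminal (hT : IsAdmissible T ℱ μ) (hf : IsMartingaleFromZero f ℱ μ) :
    Measurable (terminal (T f)) := by
  refine Measurable.iSup fun n => ?_
  exact (((hT.adapted f hf n).mono (ℱ.le n)).measurable).coe_nnreal_ennreal

theorem ae_monotone (hT : IsAdmissible T ℱ μ) (hf : IsMartingaleFromZero f ℱ μ) :
    ∀ᵐ ω ∂μ, Monotone fun n => T f n ω := by
  filter_upwards [ae_all_iff.2 (hT.increasing f hf)] with ω h
  exact monotone_nat_of_le_succ h

theorem terminal_add_le (hT : IsAdmissible T ℱ μ) (hf : IsMartingaleFromZero f ℱ μ)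
    (hg : IsMartingaleFromZero g ℱ μ) :
    ∀ᵐ ω ∂μ, terminal (T (f + g)) ω ≤ terminal (T f) ω + terminal (T g) ω := by
  filter_upwards [ae_all_iff.2 (hT.subadditive f g hf hg)] with ω h
  refine iSup_le fun n => ?_
  calc (T (f + g) n ω : ℝ≥0∞) ≤ ((T f n ω + T g n ω : ℝ≥0) : ℝ≥0∞) := ENNReal.coe_le_coe.2 (h n)
    _ = T f n ω + T g n ω := ENNReal.coe_add _ _
    _ ≤ _ := add_le_add (le_iSup (fun n => (T f n ω : ℝ≥0∞)) n)
      (le_iSup (fun n => (T g n ω : ℝ≥0∞)) n)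

/-- The growth condition, summed over time: the terminal value is at most the total variation. -/
theorem terminal_le_tsum (hT : IsAdmissible T ℱ μ) (hf : IsMartingaleFromZero f ℱ μ) :
    ∀ᵐ ω ∂μ, terminal (T f) ω ≤ ∑' n, ‖d f (n + 1) ω‖ₑ := by
  filter_upwards [ae_all_iff.2 (hT.growth f hf), hT.zero f hf] with ω h h0
  refine iSup_le fun n => le_trans ?_ (ENNReal.sum_le_tsum (Finset.range n))
  induction n with
  | zero => simp [h0]
  | succ n ih =>
    rw [Finset.sum_range_succ]
    refine le_trans (ENNReal.coe_le_coe.2 (h n)) ?_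
    rw [ENNReal.coe_add]
    exact add_le_add ih le_rfl

theorem terminal_zero (hT : IsAdmissible T ℱ μ) : ∀ᵐ ω ∂μ, terminal (T 0) ω = 0 := by
  filter_upwards [hT.terminal_le_tsum IsMartingaleFromZero.zero] with ω h
  simpa [d] using h

/-- After the stopping time the operator no longer sees the stopped martingale move, so that the
terminal value for the stopped martingale is the value at the stopping time. -/
theorem terminal_stoppedProcess [IsFiniteMeasure μ] (hT : IsAdmissible T ℱ μ)
    (hf : IsMartingaleFromZero f ℱ μ) {τ : Ω → WithTop ℕ} (hτ : IsStoppingTime ℱ τ) :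
    ∀ᵐ ω ∂μ, terminal (T (stoppedProcess f τ)) ω = valueAt (T f) τ ω := by
  have hs := hf.stopped hτ
  filter_upwards [hT.stopping f hf τ hτ, ae_all_iff.2 (hT.growth _ hs), hT.ae_monotone hs]
    with ω h1 h2 h3
  rw [h1]
  obtain hk | ⟨k, hk⟩ := eq_top_or_eq_coe (τ ω)
  · rw [valueAt_of_eq_top hk]
  · rw [valueAt_of_eq_coe hk]
    refine le_antisymm (terminal_le_of_forall_le fun n => ?_)
      (le_iSup (fun n => (T (stoppedProcess f τ) n ω : ℝ≥0∞)) k)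
    obtain hn | hn := le_total n k
    · exact h3 hn
    · induction n, hn using Nat.le_induction with
      | base => exact le_rfl
      | succ n hn ih =>
        refine (h2 n).trans ?_
        rw [d_stoppedProcess, Set.indicator_of_notMem]
        · simpa using ih
        · simpa [hk] using hn

/-- At the first time at which a process `V ≥ T f` exceeds the level `a`, the value of `T f` is at
most `a + c` if `c` bounds the increments of `f` up to that time: before it `T f ≤ a`, and the last
step adds at most `c`. -/
theorem valueAt_hittingAfter_le (hT : IsAdmissible T ℱ μ) (hf : IsMartingaleFromZero f ℱ μ)
    {V : ℕ → Ω → ℝ≥0} (hV : ∀ n ω, T f n ω ≤ V n ω) (a : ℝ≥0) :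
    ∀ᵐ ω ∂μ, ∀ c : ℝ≥0,
      (∀ n : ℕ, (n : WithTop ℕ) < hittingAfter V (Set.Ioi a) 0 ω → ‖d f (n + 1) ω‖₊ ≤ c) →
        valueAt (T f) (hittingAfter V (Set.Ioi a) 0) ω ≤ (a + c : ℝ≥0) := by
  filter_upwards [ae_all_iff.2 (hT.growth f hf), hT.zero f hf] with ω h h0 c hc
  have key : ∀ n : ℕ, (n : WithTop ℕ) < hittingAfter V (Set.Ioi a) 0 ω → T f n ω ≤ a :=
    fun n hn => (hV n ω).trans (not_lt.1 (notMem_of_lt_hittingAfter hn (Nat.zero_le n)))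
  obtain hk | ⟨k, hk⟩ := eq_top_or_eq_coe (hittingAfter V (Set.Ioi a) 0 ω)
  · rw [valueAt_of_eq_top hk]
    refine terminal_le_of_forall_le fun n => (key n ?_).trans le_self_add
    rw [hk]; exact WithTop.coe_lt_top n
  · rw [valueAt_of_eq_coe hk]
    cases k with
    | zero => rw [h0]; simp
    | succ k =>
      have hlt : (k : WithTop ℕ) < hittingAfter V (Set.Ioi a) 0 ω := by
        rw [hk]; exact Nat.cast_lt.2 k.lt_succ_self
      exact ENNReal.coe_le_coe.2 ((h k).trans (add_le_add (key k hlt) (hc k hlt)))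

end IsAdmissible

theorem lt_terminal_iff {A : ℕ → Ω → ℝ≥0} {ω : Ω} {a : ℝ≥0} :
    (a : ℝ≥0∞) < terminal A ω ↔ ∃ n, a < A n ω := by
  simp [terminal, lt_iSup_iff]

theorem hittingAfter_eq_top_iff_terminal_le {A : ℕ → Ω → ℝ≥0} {ω : Ω} {a : ℝ≥0} :
    hittingAfter A (Set.Ioi a) 0 ω = ⊤ ↔ terminal A ω ≤ a := by
  rw [hittingAfter_eq_top_iff, ← not_lt, lt_terminal_iff]
  simp

theorem isStoppingTime_hittingAfter_Ioi {A : ℕ → Ω → ℝ≥0} (hA : StronglyAdapted ℱ A) (a : ℝ≥0) :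
    IsStoppingTime ℱ (hittingAfter A (Set.Ioi a) 0) :=
  hA.adapted.isStoppingTime_hittingAfter measurableSet_Ioi

omit [NormedSpace ℝ X] [CompleteSpace X] in
theorem stoppedProcess_sub_stoppedProcess (f : ℕ → Ω → X) (σ : Ω → WithTop ℕ) :
    stoppedProcess (f - stoppedProcess f σ) σ = 0 := by
  have h : stoppedProcess (f - stoppedProcess f σ) σ
      = stoppedProcess f σ - stoppedProcess (stoppedProcess f σ) σ := rfl
  rw [h, stoppedProcess_stoppedProcess_of_le_left le_rfl, sub_self]

/-- The good-λ inequality for martingales whose increments have an adapted bound one step ahead.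
It results from the weak-type bound for the part of the martingale between the time at which `T g`
exceeds `l` and the time at which `U g` or the bound exceeds `δ l`. -/
theorem good_lambda [IsFiniteMeasure μ] (hT : IsAdmissible T ℱ μ) (hU : IsAdmissible U ℱ μ)
    (hE : IsEven U ℱ μ) {r : ℝ} (hr : 0 < r) {K : ℝ≥0} (hW : WeakTypeBound T U ℱ μ r K)
    (hg : IsMartingaleFromZero g ℱ μ) {w : ℕ → Ω → ℝ≥0} (hw : StronglyAdapted ℱ w)
    (hgw : ∀ᵐ ω ∂μ, ∀ n, ‖d g (n + 1) ω‖₊ ≤ w n ω) {l δ : ℝ≥0} (hl : 0 < l) (hδ1 : δ < 1) :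
    μ {ω | ((2 * l : ℝ≥0) : ℝ≥0∞) < terminal (T g) ω} ≤
      K * (4 * δ / (1 - δ) : ℝ≥0) ^ r * μ {ω | (l : ℝ≥0∞) < terminal (T g) ω} +
        μ {ω | ((δ * l : ℝ≥0) : ℝ≥0∞) < max (terminal (U g) ω) (terminal w ω)} := by
  set V : ℕ → Ω → ℝ≥0 := fun n ω => max (U g n ω) (w n ω) with hVdef
  have hVad : StronglyAdapted ℱ V := fun n => 
    (continuous_fst.max continuous_snd).comp_stronglyMeasurable ((hU.adapted g hg n).prodMk (hw n))
  have hVt : ∀ ω, terminal V ω = max (terminal (U g) ω) (terminal w ω) := fun ω => by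
    simp only [terminal, hVdef, ENNReal.coe_max]
    exact iSup_sup_eq
  set σ := hittingAfter (T g) (Set.Ioi l) 0 with hσdef
  set ρ := hittingAfter V (Set.Ioi (δ * l)) 0 with hρdef
  have hσ : IsStoppingTime ℱ σ := isStoppingTime_hittingAfter_Ioi (hT.adapted g hg) l
  have hρ : IsStoppingTime ℱ ρ := isStoppingTime_hittingAfter_Ioi hVad (δ * l)
  have hgσ := hg.stopped hσ
  have hgρ := hg.stopped hρ
  have hgρσ := hgρ.stopped hσ
  have hk := hg.sub hgσ
  set h := stoppedProcess (g - stoppedProcess g σ) ρ with hhdef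
  have hh : IsMartingaleFromZero h ℱ μ := hk.stopped hρ
  have hh_eq : h = stoppedProcess g ρ - stoppedProcess (stoppedProcess g ρ) σ := by
    have : h = stoppedProcess g ρ - stoppedProcess (stoppedProcess g σ) ρ := rfl
    rw [this, stoppedProcess_stoppedProcess, stoppedProcess_stoppedProcess, inf_comm]
  have hhσ : stoppedProcess h σ = 0 := by
    rw [hh_eq]; exact stoppedProcess_sub_stoppedProcess _ _
  -- `U h` vanishes unless `σ` is finite, and never exceeds `4 δ l`
  have hUh : ∀ᵐ ω ∂μ, terminal (U h) ω ≤
      {ω | (l : ℝ≥0∞) < terminal (T g) ω}.indicator (fun _ => ((4 * δ * l : ℝ≥0) : ℝ≥0∞)) ω := by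
    have hadd := hU.terminal_add_le hgρ hgρσ.neg
    rw [← sub_eq_add_neg, ← hh_eq] at hadd
    have hst := hU.terminal_stoppedProcess hh hσ
    rw [hhσ] at hst
    filter_upwards [hadd, ae_all_iff.2 (hE _ hgρσ), hU.terminal_stoppedProcess hgρ hσ,
      hU.terminal_stoppedProcess hg hρ, hst, hU.terminal_zero, hgw,
      hU.valueAt_hittingAfter_le hg (V := V) (fun n ω => le_max_left _ _) (δ * l)]
      with ω h1 h2 h3 h4 h5 h6 h7 h8
    by_cases hω : (l : ℝ≥0∞) < terminal (T g) ω
    · rw [Set.indicator_of_mem (by exact hω)]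
      have e1 : terminal (U (-(stoppedProcess (stoppedProcess g ρ) σ))) ω
          = terminal (U (stoppedProcess (stoppedProcess g ρ) σ)) ω := by
        simp only [terminal, h2]
      have e2 : valueAt (U g) ρ ω ≤ ((δ * l + δ * l : ℝ≥0) : ℝ≥0∞) := by
        refine h8 _ fun n hn => (h7 n).trans ?_
        have hV : V n ω ∉ Set.Ioi (δ * l) := notMem_of_lt_hittingAfter hn (Nat.zero_le n)
        exact (le_max_right _ _).trans (not_lt.1 hV)
      calc terminal (U h) ω
          ≤ terminal (U (stoppedProcess g ρ)) ω + terminal (U (stoppedProcess g ρ)) ω := by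
            refine h1.trans (add_le_add le_rfl ?_)
            rw [e1, h3]
            exact valueAt_le_terminal _ _ _
        _ ≤ ((δ * l + δ * l : ℝ≥0) : ℝ≥0∞) + ((δ * l + δ * l : ℝ≥0) : ℝ≥0∞) := by
            rw [h4]; exact add_le_add e2 e2
        _ = ((4 * δ * l : ℝ≥0) : ℝ≥0∞) := by
            rw [← ENNReal.coe_add]; congr 1; ring
    · rw [Set.indicator_of_notMem (by exact hω)]
      have : σ ω = ⊤ := hittingAfter_eq_top_iff_terminal_le.2 (not_lt.1 hω)
      rw [valueAt_of_eq_top this] at h5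
      rw [← h5, h6]
  have hA : MeasurableSet {ω | (l : ℝ≥0∞) < terminal (T g) ω} :=
    measurableSet_lt measurable_const (hT.measurable_terminal hg)
  have hnorm : eLpNorm (terminal (U h)) (ENNReal.ofReal r) μ ^ r ≤
      ((4 * δ * l : ℝ≥0) : ℝ≥0∞) ^ r * μ {ω | (l : ℝ≥0∞) < terminal (T g) ω} := by
    rw [eLpNorm_ofReal_rpow hr, ← lintegral_indicator_const hA]
    refine lintegral_mono_ae ?_
    filter_upwards [hUh] with ω hω
    refine (ENNReal.rpow_le_rpow hω hr.le).trans ?_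
    by_cases hmem : ω ∈ {ω | (l : ℝ≥0∞) < terminal (T g) ω}
    · rw [Set.indicator_of_mem hmem, Set.indicator_of_mem hmem]
    · rw [Set.indicator_of_notMem hmem, Set.indicator_of_notMem hmem, ENNReal.zero_rpow_of_pos hr]
  -- where `ρ` is infinite, `T h` has to grow from `(1 + δ) l` to `2 l`
  have hsub : ∀ᵐ ω ∂μ, ω ∈ {ω | ((2 * l : ℝ≥0) : ℝ≥0∞) < terminal (T g) ω} →
      ω ∈ {ω | (((1 - δ) * l : ℝ≥0) : ℝ≥0∞) < terminal (T h) ω} ∪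
        {ω | ((δ * l : ℝ≥0) : ℝ≥0∞) < max (terminal (U g) ω) (terminal w ω)} := by
    have hadd := hT.terminal_add_le hk hgσ
    rw [sub_add_cancel] at hadd
    filter_upwards [hadd, hT.terminal_stoppedProcess hg hσ, hT.terminal_stoppedProcess hk hρ, hgw,
      hT.valueAt_hittingAfter_le hg (V := T g) (fun n ω => le_rfl) l] with ω h1 h2 h3 h4 h5 h6
    by_contra hcon
    rw [Set.mem_union, not_or] at hcon
    obtain ⟨hc1, hc2⟩ := hcon
    have hc1 : terminal (T h) ω ≤ _ := not_lt.1 hc1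
    have hc2 : max (terminal (U g) ω) (terminal w ω) ≤ _ := not_lt.1 hc2
    have hρω : ρ ω = ⊤ := hittingAfter_eq_top_iff_terminal_le.2 (by rw [hVt]; exact hc2)
    have e1 : valueAt (T g) σ ω ≤ ((l + δ * l : ℝ≥0) : ℝ≥0∞) := by
      refine h5 _ fun n _ => (h4 n).trans (ENNReal.coe_le_coe.1 ?_)
      exact (le_iSup (fun n => (w n ω : ℝ≥0∞)) n).trans ((le_max_right _ _).trans hc2)
    rw [valueAt_of_eq_top hρω] at h3
    rw [← h3, h2] at h1
    have h7 := h1.trans (add_le_add hc1 e1)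
    rw [← ENNReal.coe_add] at h7
    have h8 : (1 - δ) * l + (l + δ * l) = 2 * l := by
      calc (1 - δ) * l + (l + δ * l) = ((1 - δ) + δ) * l + l := by ring
        _ = 2 * l := by rw [tsub_add_cancel_of_le hδ1.le]; ring
    rw [h8] at h7
    exact absurd h6 (not_lt.2 h7)
  have hpos : 0 < (1 - δ) * l := mul_pos (tsub_pos_of_lt hδ1) hl
  have hweak : μ {ω | (((1 - δ) * l : ℝ≥0) : ℝ≥0∞) < terminal (T h) ω} ≤
      K * (4 * δ / (1 - δ) : ℝ≥0) ^ r * μ {ω | (l : ℝ≥0∞) < terminal (T g) ω} := by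
    have h1 := hW h hh ((1 - δ) * l : ℝ≥0) (by exact_mod_cast hpos)
    rw [ENNReal.ofReal_coe_nnreal] at h1
    refine h1.trans ((mul_le_mul_right hnorm _).trans ?_)
    rw [← mul_assoc]
    refine mul_le_mul_left (le_of_eq ?_) _
    rw [mul_assoc]
    congr 1
    have e1 : ENNReal.ofReal ((((1 - δ) * l : ℝ≥0) : ℝ) ^ (-r))
        = ((((1 - δ) * l) ^ (-r) : ℝ≥0) : ℝ≥0∞) := by
      rw [← NNReal.coe_rpow, ENNReal.ofReal_coe_nnreal]
    rw [e1, ← ENNReal.coe_rpow_of_nonneg _ hr.le, ← ENNReal.coe_rpow_of_nonneg _ hr.le,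
      ← ENNReal.coe_mul, NNReal.rpow_neg, ← NNReal.inv_rpow, ← NNReal.mul_rpow]
    congr 2
    have := (tsub_pos_of_lt hδ1).ne'
    field_simp
  calc μ {ω | ((2 * l : ℝ≥0) : ℝ≥0∞) < terminal (T g) ω}
      ≤ μ ({ω | (((1 - δ) * l : ℝ≥0) : ℝ≥0∞) < terminal (T h) ω} ∪
        {ω | ((δ * l : ℝ≥0) : ℝ≥0∞) < max (terminal (U g) ω) (terminal w ω)}) :=
        measure_mono_ae hsub
    _ ≤ _ := measure_union_le _ _
    _ ≤ _ := add_le_add hweak le_rfl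

end Admissible

/-! ### From good-λ inequalities to moments -/

section GoodLambda

variable {Ω : Type*} {m0 : MeasurableSpace Ω} {μ : Measure Ω}

theorem lintegral_rpow_eq_lintegral_meas_lt {F : Ω → ℝ≥0∞} (hF : Measurable F)
    (hfin : ∀ ω, F ω ≠ ∞) {q : ℝ} (hq : 0 < q) :
    ∫⁻ ω, F ω ^ q ∂μ = ENNReal.ofReal q * ∫⁻ t in Set.Ioi (0 : ℝ),
      μ {ω | ENNReal.ofReal t < F ω} * ENNReal.ofReal (t ^ (q - 1)) := by
  have h := lintegral_rpow_eq_lintegral_meas_lt_mul μ (f := fun ω => (F ω).toReal)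
    (Filter.Eventually.of_forall fun ω => ENNReal.toReal_nonneg) hF.ennreal_toReal.aemeasurable hq
  have e1 : ∀ ω, ENNReal.ofReal ((F ω).toReal ^ q) = F ω ^ q := fun ω => by
    rw [← ENNReal.ofReal_rpow_of_nonneg ENNReal.toReal_nonneg hq.le,
      ENNReal.ofReal_toReal (hfin ω)]
  simp_rw [e1] at h
  rw [h]
  congr 1
  refine setLIntegral_congr_fun measurableSet_Ioi fun t ht => ?_
  have : {ω | t < (F ω).toReal} = {ω | ENNReal.ofReal t < F ω} := by
    ext ω
    exact (ENNReal.ofReal_lt_iff_lt_toReal (le_of_lt ht) (hfin ω)).symm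
  simp only [this]

/-- A good-λ inequality compares moments. The function `Y` is truncated to make its moment finite;
truncation at a common level preserves the inequality. -/
theorem lintegral_rpow_le_of_good_lambda [IsFiniteMeasure μ] {Y Z : Ω → ℝ≥0∞} (hY : Measurable Y)
    (hZ : Measurable Z) {q : ℝ} (hq : 0 < q) {ε : ℝ≥0∞} (hε : ε ≤ 2⁻¹ * 2⁻¹ ^ q)
    (h : ∀ l : ℝ≥0, 0 < l → μ {ω | ((2 * l : ℝ≥0) : ℝ≥0∞) < Y ω} ≤
      ε * μ {ω | (l : ℝ≥0∞) < Y ω} + μ {ω | (l : ℝ≥0∞) < Z ω}) :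
    ∫⁻ ω, Y ω ^ q ∂μ ≤ 2 * 2 ^ q * ∫⁻ ω, Z ω ^ q ∂μ := by
  have htrunc : ∀ N : ℕ, ∫⁻ ω, (min (Y ω) N) ^ q ∂μ ≤ 2 * 2 ^ q * ∫⁻ ω, Z ω ^ q ∂μ := by
    intro N
    have hYN : Measurable fun ω => min (Y ω) N := hY.min measurable_const
    have hZN : Measurable fun ω => min (Z ω) N := hZ.min measurable_const
    have hfinY : ∀ ω, min (Y ω) (N : ℝ≥0∞) ≠ ∞ := fun ω =>
      ne_top_of_le_ne_top (ENNReal.natCast_ne_top N) (min_le_right _ _)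
    have hfinZ : ∀ ω, min (Z ω) (N : ℝ≥0∞) ≠ ∞ := fun ω =>
      ne_top_of_le_ne_top (ENNReal.natCast_ne_top N) (min_le_right _ _)
    have hI : ∫⁻ ω, (min (Y ω) N) ^ q ∂μ ≠ ∞ := by
      refine ne_top_of_le_ne_top (b := ∫⁻ _, (N : ℝ≥0∞) ^ q ∂μ) ?_
        (lintegral_mono fun ω => ENNReal.rpow_le_rpow (min_le_right _ _) hq.le)
      rw [lintegral_const]
      exact ENNReal.mul_ne_top (ENNReal.rpow_ne_top_of_nonneg hq.le (ENNReal.natCast_ne_top N))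
        (measure_ne_top _ _)
    have hhalf : ∫⁻ ω, (2⁻¹ * min (Y ω) N) ^ q ∂μ ≤
        ε * ∫⁻ ω, (min (Y ω) N) ^ q ∂μ + ∫⁻ ω, (min (Z ω) N) ^ q ∂μ := by
      rw [lintegral_rpow_eq_lintegral_meas_lt (hYN.const_mul _)
          (fun ω => ENNReal.mul_ne_top (by simp) (hfinY ω)) hq,
        lintegral_rpow_eq_lintegral_meas_lt hYN hfinY hq,
        lintegral_rpow_eq_lintegral_meas_lt hZN hfinZ hq, mul_left_comm, ← mul_add]
      refine mul_le_mul_right ?_ _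
      have hmeas : Measurable fun t : ℝ =>
          μ {ω | ENNReal.ofReal t < min (Y ω) N} * ENNReal.ofReal (t ^ (q - 1)) := by
        refine Measurable.mul ?_ (by fun_prop)
        have hanti : Antitone fun t : ℝ => μ {ω | ENNReal.ofReal t < min (Y ω) N} :=
          fun s t hst => measure_mono fun ω hω => (ENNReal.ofReal_le_ofReal hst).trans_lt hω
        exact hanti.measurable
      rw [← lintegral_const_mul _ hmeas, ← lintegral_add_left (hmeas.const_mul _)]
      refine setLIntegral_mono' measurableSet_Ioi fun t ht => ?_
      rw [← mul_assoc, ← add_mul]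
      refine mul_le_mul_left ?_ _
      set l : ℝ≥0 := t.toNNReal with hl
      have hlpos : 0 < l := Real.toNNReal_pos.2 ht
      have htl : ENNReal.ofReal t = (l : ℝ≥0∞) := rfl
      have hset : {ω | ENNReal.ofReal t < 2⁻¹ * min (Y ω) N}
          = {ω | ((2 * l : ℝ≥0) : ℝ≥0∞) < min (Y ω) N} := by
        ext ω
        simp only [Set.mem_ofPred_eq, htl, ENNReal.coe_mul, ENNReal.coe_ofNat]
        rw [← ENNReal.div_eq_inv_mul, ENNReal.lt_div_iff_mul_lt (by simp) (by simp), mul_comm]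
      rw [hset, htl]
      by_cases hlN : ((2 * l : ℝ≥0) : ℝ≥0∞) < N
      · have hlN' : (l : ℝ≥0∞) < N := lt_of_le_of_lt
          (ENNReal.coe_le_coe.2 (le_mul_of_one_le_left l.2 one_le_two)) hlN
        simpa only [lt_min_iff, hlN, hlN', and_true] using h l hlpos
      · simp only [lt_min_iff, hlN, and_false]
        simp
    have hscale : ∫⁻ ω, (2⁻¹ * min (Y ω) N) ^ q ∂μ = 2⁻¹ ^ q * ∫⁻ ω, (min (Y ω) N) ^ q ∂μ := by
      simp_rw [ENNReal.mul_rpow_of_nonneg _ _ hq.le]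
      exact lintegral_const_mul _ (hYN.pow_const q)
    rw [hscale] at hhalf
    set I := ∫⁻ ω, (min (Y ω) N) ^ q ∂μ
    have hc0 : (2⁻¹ : ℝ≥0∞) ^ q ≠ ∞ := ENNReal.rpow_ne_top_of_nonneg hq.le (by simp)
    -- half of the left-hand side is absorbed
    have h1 : 2⁻¹ * 2⁻¹ ^ q * I + 2⁻¹ * 2⁻¹ ^ q * I
        ≤ 2⁻¹ * 2⁻¹ ^ q * I + ∫⁻ ω, (min (Z ω) N) ^ q ∂μ := by
      calc 2⁻¹ * 2⁻¹ ^ q * I + 2⁻¹ * 2⁻¹ ^ q * I = (2⁻¹ + 2⁻¹) * (2⁻¹ ^ q * I) := by ring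
        _ = 2⁻¹ ^ q * I := by rw [ENNReal.inv_two_add_inv_two, one_mul]
        _ ≤ _ := hhalf
        _ ≤ _ := add_le_add (mul_le_mul_left hε _) le_rfl
    have h2 : 2⁻¹ * 2⁻¹ ^ q * I ≤ ∫⁻ ω, (min (Z ω) N) ^ q ∂μ :=
      (ENNReal.add_le_add_iff_left
        (ENNReal.mul_ne_top (ENNReal.mul_ne_top (by simp) hc0) hI)).1 h1
    have h3 : I = 2 * 2 ^ q * (2⁻¹ * 2⁻¹ ^ q * I) := by
      have e1 : (2 : ℝ≥0∞) ^ q * 2⁻¹ ^ q = 1 := by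
        rw [← ENNReal.mul_rpow_of_nonneg _ _ hq.le, ENNReal.mul_inv_cancel (by simp) (by simp),
          ENNReal.one_rpow]
      have e2 : (2 : ℝ≥0∞) * 2⁻¹ = 1 := ENNReal.mul_inv_cancel (by simp) (by simp)
      calc I = (2 * 2⁻¹) * (2 ^ q * 2⁻¹ ^ q) * I := by rw [e1, e2, one_mul, one_mul]
        _ = _ := by ring
    rw [h3]
    refine mul_le_mul_right (h2.trans (lintegral_mono fun ω => ?_)) _
    exact ENNReal.rpow_le_rpow (min_le_left _ _) hq.le
  have hsup : ∀ ω, Y ω ^ q = ⨆ N : ℕ, (min (Y ω) N) ^ q := by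
    intro ω
    have h1 : Y ω = ⨆ N : ℕ, min (Y ω) N := by
      rw [← inf_iSup_eq, ENNReal.iSup_natCast, inf_top_eq]
    conv_lhs => rw [h1]
    exact (ENNReal.orderIsoRpow q hq).map_iSup _
  simp_rw [hsup]
  rw [lintegral_iSup (fun N => (hY.min measurable_const).pow_const q)]
  · exact iSup_le htrunc
  · intro M N hMN ω
    exact ENNReal.rpow_le_rpow (min_le_min le_rfl (Nat.cast_le.2 hMN)) hq.le

end GoodLambda

/-! ### The dual Doob inequality -/

section DualDoob

variable {Ω : Type*} {m0 : MeasurableSpace Ω} {μ : Measure Ω}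

/-- The pull-out property of the conditional expectation, in integrated form. -/
theorem lintegral_mul_condLExp {m : MeasurableSpace Ω} (hm : m ≤ m0) [SigmaFinite (μ.trim hm)]
    {G a : Ω → ℝ≥0∞} (hG : Measurable[m] G) (ha : Measurable[m0] a) :
    ∫⁻ ω, G ω * (μ⁻[a|m]) ω ∂μ = ∫⁻ ω, G ω * a ω ∂μ := by
  have hc : @Measurable _ _ m0 _ (μ⁻[a|m]) := measurable_condLExp' m μ a
  have htrim : (μ.withDensity (μ⁻[a|m])).trim hm = (μ.withDensity a).trim hm := by
    refine @Measure.ext _ m _ _ fun s hs => ?_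
    rw [trim_measurableSet_eq hm hs, trim_measurableSet_eq hm hs,
      withDensity_apply _ (hm s hs), withDensity_apply _ (hm s hs), setLIntegral_condLExp hm μ a hs]
  have h1 := lintegral_withDensity_eq_lintegral_mul μ hc (hG.mono hm le_rfl)
  have h2 := lintegral_withDensity_eq_lintegral_mul μ ha (hG.mono hm le_rfl)
  simp only [Pi.mul_apply] at h1 h2
  simp_rw [mul_comm (G _)]
  rw [← h1, ← h2, ← lintegral_trim hm hG, ← lintegral_trim hm hG, htrim]

/-- A discrete form of `d(A^q) ≤ q A^(q-1) dA`. -/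
theorem add_rpow_le_rpow_add_mul {q : ℝ} (hq : 1 ≤ q) (a c : ℝ≥0) :
    (a + c) ^ q ≤ a ^ q + q.toNNReal * ((a + c) ^ (q - 1) * c) := by
  rw [← NNReal.coe_le_coe]
  push_cast
  rw [Real.coe_toNNReal q (by linarith)]
  obtain hs | hs := eq_or_lt_of_le (add_nonneg a.2 c.2)
  · have ha : (a : ℝ) = 0 := by have := a.2; have := c.2; simp only [NNReal.val_eq_coe] at *; linarith
    have hc : (c : ℝ) = 0 := by have := a.2; have := c.2; simp only [NNReal.val_eq_coe] at *; linarith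
    simp [ha, hc]
  · simp only [NNReal.val_eq_coe] at hs
    set s : ℝ := a + c with hsdef
    -- Bernoulli's inequality at `a / s`
    have hb := one_add_mul_self_le_rpow_one_add (s := (a : ℝ) / s - 1) (p := q)
      (by have : 0 ≤ (a : ℝ) / s := by positivity
          linarith) hq
    rw [add_sub_cancel, Real.div_rpow a.coe_nonneg hs.le] at hb
    have hsq : 0 < s ^ q := Real.rpow_pos_of_pos hs q
    rw [le_div_iff₀ hsq] at hb
    have hs1 : s ^ q = s ^ (q - 1) * s := by
      rw [← Real.rpow_add_one hs.ne']; ring_nf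
    have hac : (a : ℝ) / s * s = a := div_mul_cancel₀ _ hs.ne'
    have : (1 + q * ((a : ℝ) / s - 1)) * s ^ q = s ^ q - q * (s ^ (q - 1) * c) := by
      have hc : (c : ℝ) = s - a := by rw [hsdef]; ring
      rw [hc]
      calc (1 + q * ((a : ℝ) / s - 1)) * s ^ q
          = s ^ q + q * (((a : ℝ) / s - 1) * (s ^ (q - 1) * s)) := by rw [← hs1]; ring
        _ = s ^ q + q * (s ^ (q - 1) * ((a : ℝ) / s * s - s)) := by ring
        _ = _ := by rw [hac]; ring
    rw [this] at hb
    linarith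

theorem add_rpow_le_rpow_add_mul_ennreal {q : ℝ} (hq : 1 ≤ q) {a c : ℝ≥0∞} :
    (a + c) ^ q ≤ a ^ q + ENNReal.ofReal q * ((a + c) ^ (q - 1) * c) := by
  have hq0 : 0 < q := by linarith
  have hofq : ENNReal.ofReal q ≠ 0 := by simpa using hq0
  induction a with
  | top => simp [ENNReal.top_rpow_of_pos hq0]
  | coe a =>
    induction c with
    | top =>
      obtain h | h := eq_or_lt_of_le hq
      · simp [← h]
      · have : 0 < q - 1 := by linarith
        simp [ENNReal.top_rpow_of_pos this, ENNReal.mul_top hofq]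
    | coe c =>
      have h := ENNReal.coe_le_coe.2 (add_rpow_le_rpow_add_mul hq a c)
      push_cast at h
      rw [ENNReal.coe_rpow_of_nonneg _ hq0.le, ENNReal.coe_rpow_of_nonneg _ hq0.le,
        ENNReal.coe_rpow_of_nonneg _ (by linarith : 0 ≤ q - 1)] at h
      push_cast at h
      exact h

theorem sum_rpow_le {q : ℝ} (hq : 1 ≤ q) (c : ℕ → ℝ≥0∞) (N : ℕ) :
    (∑ n ∈ Finset.range N, c n) ^ q ≤ ENNReal.ofReal q *
      ∑ n ∈ Finset.range N, (∑ k ∈ Finset.range (n + 1), c k) ^ (q - 1) * c n := by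
  induction N with
  | zero => simp [ENNReal.zero_rpow_of_pos (by linarith : 0 < q)]
  | succ N ih =>
    rw [Finset.sum_range_succ _ N, Finset.sum_range_succ _ N, mul_add]
    refine (add_rpow_le_rpow_add_mul_ennreal hq).trans (add_le_add ih ?_)
    rw [← Finset.sum_range_succ]

/-- The dual Doob inequality under the assumption that the left-hand side is finite. Summation by
parts brings in the predictable factors `A_{n+1}^(q-1)`, against which `c n` may be replaced with
`a n`; Hölder's inequality concludes. -/
theorem lintegral_sum_rpow_le_of_ne_top {q : ℝ} (hq : 1 ≤ q) {a c : ℕ → Ω → ℝ≥0∞}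
    (ha : ∀ n, Measurable (a n)) (hc : ∀ n, Measurable (c n)) (N : ℕ)
    (hac : ∀ n, ∫⁻ ω, (∑ k ∈ Finset.range (n + 1), c k ω) ^ (q - 1) * c n ω ∂μ =
      ∫⁻ ω, (∑ k ∈ Finset.range (n + 1), c k ω) ^ (q - 1) * a n ω ∂μ)
    (hfin : ∫⁻ ω, (∑ n ∈ Finset.range N, c n ω) ^ q ∂μ ≠ ∞) :
    ∫⁻ ω, (∑ n ∈ Finset.range N, c n ω) ^ q ∂μ ≤
      ENNReal.ofReal q ^ q * ∫⁻ ω, (∑ n ∈ Finset.range N, a n ω) ^ q ∂μ := by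
  have hq0 : 0 < q := by linarith
  set A : ℕ → Ω → ℝ≥0∞ := fun n ω => ∑ k ∈ Finset.range n, c k ω with hA
  set Z : Ω → ℝ≥0∞ := fun ω => ∑ n ∈ Finset.range N, a n ω with hZ
  have hAm : ∀ n, Measurable (A n) := fun n => Finset.measurable_sum _ fun k _ => hc k
  have hZm : Measurable Z := Finset.measurable_sum _ fun k _ => ha k
  have h1 : ∫⁻ ω, A N ω ^ q ∂μ ≤ ENNReal.ofReal q * ∫⁻ ω, A N ω ^ (q - 1) * Z ω ∂μ := by
    calc ∫⁻ ω, A N ω ^ q ∂μ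
        ≤ ∫⁻ ω, ENNReal.ofReal q * ∑ n ∈ Finset.range N, A (n + 1) ω ^ (q - 1) * c n ω ∂μ :=
          lintegral_mono fun ω => sum_rpow_le hq (fun n => c n ω) N
      _ = ENNReal.ofReal q * ∑ n ∈ Finset.range N, ∫⁻ ω, A (n + 1) ω ^ (q - 1) * c n ω ∂μ := by
          rw [lintegral_const_mul' _ _ ENNReal.ofReal_ne_top]
          congr 1
          refine lintegral_finsetSum _ ?_
          exact fun n _ => ((hAm (n + 1)).pow_const (q - 1)).mul (hc n)
      _ = ENNReal.ofReal q * ∫⁻ ω, ∑ n ∈ Finset.range N, A (n + 1) ω ^ (q - 1) * a n ω ∂μ := by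
          congr 1
          refine Eq.trans (Finset.sum_congr rfl fun n _ => hac n) (lintegral_finsetSum _ ?_).symm
          exact fun n _ => ((hAm (n + 1)).pow_const (q - 1)).mul (ha n)
      _ ≤ _ := by
          refine mul_le_mul_right (lintegral_mono fun ω => ?_) _
          rw [hZ, Finset.mul_sum]
          refine Finset.sum_le_sum fun n hn => mul_le_mul_left ?_ _
          refine ENNReal.rpow_le_rpow ?_ (by linarith)
          exact Finset.sum_le_sum_of_subset (Finset.range_subset_range.2 (Finset.mem_range.1 hn))
  obtain rfl | hq1 := eq_or_lt_of_le hq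
  · simpa using h1
  have hpq : q.HolderConjugate (q / (q - 1)) := Real.HolderConjugate.conjExponent hq1
  have h2 := ENNReal.lintegral_mul_le_Lp_mul_Lq μ hpq.symm ((hAm N).pow_const (q - 1)).aemeasurable
    hZm.aemeasurable
  have e1 : ∀ ω, (A N ω ^ (q - 1)) ^ (q / (q - 1)) = A N ω ^ q := fun ω => by
    rw [← ENNReal.rpow_mul, mul_div_cancel₀ _ (by linarith : q - 1 ≠ 0)]
  simp only [Pi.mul_apply, e1] at h2
  set I := ∫⁻ ω, A N ω ^ q ∂μ with hI
  set J := ∫⁻ ω, Z ω ^ q ∂μ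
  obtain hI0 | hI0 := eq_or_ne I 0
  · rw [hI0]; exact zero_le
  -- divide by the power of `I` that Hölder's inequality produces
  have h3 : I ^ (1 / q) * I ^ (1 / (q / (q - 1))) ≤
      ENNReal.ofReal q * J ^ (1 / q) * I ^ (1 / (q / (q - 1))) := by
    rw [← ENNReal.rpow_add _ _ hI0 hfin]
    have : 1 / q + 1 / (q / (q - 1)) = 1 := by simpa [one_div] using hpq.inv_add_inv_eq_one
    rw [this, ENNReal.rpow_one, mul_assoc, mul_comm (J ^ _)]
    exact h1.trans (mul_le_mul_right h2 _)
  have hpos : I ^ (1 / (q / (q - 1))) ≠ 0 := by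
    simp only [ne_eq, ENNReal.rpow_eq_zero_iff, not_or, not_and]
    exact ⟨fun h => absurd h hI0, fun h => absurd h hfin⟩
  have htop : I ^ (1 / (q / (q - 1))) ≠ ∞ :=
    ENNReal.rpow_ne_top_of_nonneg (one_div_nonneg.2 hpq.symm.nonneg) hfin
  have h4 : I ^ (1 / q) ≤ ENNReal.ofReal q * J ^ (1 / q) :=
    (ENNReal.mul_le_mul_iff_left hpos htop).1 h3
  have h5 := ENNReal.rpow_le_rpow h4 hq0.le
  rwa [ENNReal.mul_rpow_of_nonneg _ _ hq0.le, ← ENNReal.rpow_mul, ← ENNReal.rpow_mul,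
    one_div_mul_cancel hq0.ne', ENNReal.rpow_one, ENNReal.rpow_one] at h5

/-- The dual Doob inequality. The truncation `c n 1_{A_{n+1} ≤ M}` of the compensator is
predictable and has bounded partial sums. -/
theorem lintegral_tsum_condLExp_rpow_le [IsFiniteMeasure μ] {ℱ : Filtration ℕ m0} {q : ℝ}
    (hq : 1 ≤ q) {a : ℕ → Ω → ℝ≥0∞} (ha : ∀ n, Measurable (a n))
    (hafin : ∀ n, ∫⁻ ω, a n ω ∂μ ≠ ∞) :
    ∫⁻ ω, (∑' n, (μ⁻[a n|ℱ n]) ω) ^ q ∂μ ≤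
      ENNReal.ofReal q ^ q * ∫⁻ ω, (∑' n, a n ω) ^ q ∂μ := by
  have hq0 : 0 < q := by linarith
  set c : ℕ → Ω → ℝ≥0∞ := fun n => μ⁻[a n|ℱ n] with hc
  have hcm : ∀ n, Measurable[ℱ n] (c n) := fun n => measurable_condLExp _ _ _
  set A : ℕ → Ω → ℝ≥0∞ := fun n ω => ∑ k ∈ Finset.range n, c k ω with hA
  have hAm : ∀ n, Measurable[ℱ n] (A (n + 1)) := fun n =>
    Finset.measurable_sum _ fun k hk =>
      (hcm k).mono (ℱ.mono (Nat.lt_succ_iff.1 (Finset.mem_range.1 hk))) le_rfl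
  have hAm' : ∀ n, Measurable (A n) := fun n =>
    Finset.measurable_sum _ fun k _ => (hcm k).mono (ℱ.le k) le_rfl
  have htrunc : ∀ (M N : ℕ), ∫⁻ ω, (∑ n ∈ Finset.range N,
      {ω | A (n + 1) ω ≤ M}.indicator (c n) ω) ^ q ∂μ ≤
        ENNReal.ofReal q ^ q * ∫⁻ ω, (∑' n, a n ω) ^ q ∂μ := by
    intro M N
    have hs : ∀ n, MeasurableSet[ℱ n] {ω | A (n + 1) ω ≤ M} := fun n =>
      hAm n measurableSet_Iic
    set c' : ℕ → Ω → ℝ≥0∞ := fun n => {ω | A (n + 1) ω ≤ M}.indicator (c n) with hc'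
    set a' : ℕ → Ω → ℝ≥0∞ := fun n => {ω | A (n + 1) ω ≤ M}.indicator (a n) with ha'
    have hc'm : ∀ n, Measurable[ℱ n] (c' n) := fun n => (hcm n).indicator (hs n)
    have hbound : ∀ n ω, ∑ k ∈ Finset.range n, c' k ω ≤ M := by
      intro n ω
      induction n with
      | zero => simp
      | succ n ih =>
        rw [Finset.sum_range_succ]
        by_cases hω : ω ∈ {ω | A (n + 1) ω ≤ M}
        · refine le_trans ?_ hω
          rw [← Finset.sum_range_succ]
          exact Finset.sum_le_sum fun k _ => Set.indicator_le_self _ _ _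
        · rw [hc']
          simp only [Set.indicator_of_notMem hω, add_zero]
          exact ih
    refine (lintegral_sum_rpow_le_of_ne_top hq (a := a') (c := c')
      (fun n => (ha n).indicator (ℱ.le n _ (hs n))) (fun n => (hc'm n).mono (ℱ.le n) le_rfl)
      N (fun n => ?_) ?_).trans (mul_le_mul_right (lintegral_mono fun ω => ?_) _)
    · have hpull := lintegral_mul_condLExp (μ := μ) (ℱ.le n)
        (G := {ω | A (n + 1) ω ≤ M}.indicator
          fun ω => (∑ k ∈ Finset.range (n + 1), c' k ω) ^ (q - 1)) ?_ (ha n)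
      · convert hpull using 3 with ω ω
        · by_cases hω : ω ∈ {ω | A (n + 1) ω ≤ M}
          · simp only [hc', Set.indicator_of_mem hω, hc]
          · simp only [hc', Set.indicator_of_notMem hω, zero_mul, mul_zero]
        · by_cases hω : ω ∈ {ω | A (n + 1) ω ≤ M}
          · simp only [ha', Set.indicator_of_mem hω]
          · simp only [ha', Set.indicator_of_notMem hω, zero_mul, mul_zero]
      · refine Measurable.indicator (Measurable.pow_const ?_ _) (hs n)
        exact Finset.measurable_sum _ fun k hk =>
          (hc'm k).mono (ℱ.mono (Nat.lt_succ_iff.1 (Finset.mem_range.1 hk))) le_rfl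
    · refine ne_top_of_le_ne_top (b := ∫⁻ _, (M : ℝ≥0∞) ^ q ∂μ) ?_
        (lintegral_mono fun ω => ENNReal.rpow_le_rpow (hbound N ω) hq0.le)
      rw [lintegral_const]
      exact ENNReal.mul_ne_top (ENNReal.rpow_ne_top_of_nonneg hq0.le (ENNReal.natCast_ne_top M))
        (measure_ne_top _ _)
    · refine ENNReal.rpow_le_rpow ?_ hq0.le
      exact (Finset.sum_le_sum fun k _ => Set.indicator_le_self _ _ _).trans
        (ENNReal.sum_le_tsum _)
  have hfin : ∀ᵐ ω ∂μ, ∀ n, c n ω ≠ ∞ :=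
    ae_all_iff.2 fun n => condLExp_ne_top (hafin n)
  -- the truncation level may be taken to be `N`, the number of terms
  have hmono : Monotone fun (N : ℕ) (ω : Ω) => (∑ n ∈ Finset.range N,
      {ω | A (n + 1) ω ≤ N}.indicator (c n) ω) ^ q := by
    intro N N' hNN' ω
    refine ENNReal.rpow_le_rpow ?_ hq0.le
    refine le_trans (Finset.sum_le_sum_of_subset (Finset.range_subset_range.2 hNN'))
      (Finset.sum_le_sum fun n _ => ?_)
    refine Set.indicator_le_indicator_of_subset (fun ω hω => ?_) (fun _ => zero_le) ω
    exact le_trans (show A (n + 1) ω ≤ N from hω) (Nat.cast_le.2 hNN')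
  refine le_trans (lintegral_mono_ae (g := fun ω => ⨆ N : ℕ, (∑ n ∈ Finset.range N,
      {ω | A (n + 1) ω ≤ N}.indicator (c n) ω) ^ q) ?_) ?_
  · filter_upwards [hfin] with ω hω
    rw [ENNReal.tsum_eq_iSup_nat, ← ENNReal.orderIsoRpow_apply q hq0, OrderIso.map_iSup]
    refine iSup_le fun N => ?_
    have hAN : A N ω ≠ ∞ := ENNReal.sum_ne_top.2 fun n _ => hω n
    obtain ⟨M, hM⟩ := ENNReal.exists_nat_gt hAN
    refine le_trans ?_ (le_iSup _ (max N M))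
    rw [ENNReal.orderIsoRpow_apply]
    refine ENNReal.rpow_le_rpow ?_ hq0.le
    refine le_trans (Finset.sum_le_sum fun n hn => ?_)
      (Finset.sum_le_sum_of_subset (Finset.range_subset_range.2 (le_max_left N M)))
    rw [Set.indicator_of_mem]
    refine le_trans (Finset.sum_le_sum_of_subset
      (Finset.range_subset_range.2 (Finset.mem_range.1 hn))) (hM.le.trans ?_)
    exact Nat.cast_le.2 (le_max_right N M)
  · rw [lintegral_iSup (fun N => Measurable.pow_const (Finset.measurable_sum _ fun n _ =>
      ((hcm n).mono (ℱ.le n) le_rfl).indicator (measurableSet_le (hAm' _) measurable_const)) _)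
      hmono]
    exact iSup_le fun N => htrunc N N

end DualDoob

/-! ### The Davis decomposition -/

section Davis

variable {Ω X : Type*} {m0 : MeasurableSpace Ω} {μ : Measure Ω} {ℱ : Filtration ℕ m0}
  [NormedAddCommGroup X]

/-- The running maximum of the increments of `f`. -/
noncomputable def maxIncrement (f : ℕ → Ω → X) : ℕ → Ω → ℝ≥0
  | 0 => 0
  | n + 1 => fun ω => max (maxIncrement f n ω) ‖d f (n + 1) ω‖₊

theorem terminal_maxIncrement (f : ℕ → Ω → X) : terminal (maxIncrement f) = maximalFn (d f) := by
  ext ω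
  refine le_antisymm (iSup_le fun n => ?_) (iSup_le fun n => ?_)
  · induction n with
    | zero => simp [maxIncrement]
    | succ n ih =>
      rw [maxIncrement, ENNReal.coe_max]
      exact max_le ih (le_iSup (fun n => ‖d f n ω‖ₑ) (n + 1))
  · cases n with
    | zero => simp
    | succ n =>
      refine le_trans ?_ (le_iSup (fun n => (maxIncrement f n ω : ℝ≥0∞)) (n + 1))
      exact ENNReal.coe_le_coe.2 (le_max_right _ _)

/-- The large increments: those that exceed twice the maximum of the preceding ones. The increment
at time `n + 1` has index `n`. -/
noncomputable def largeIncrement (f : ℕ → Ω → X) (n : ℕ) : Ω → X :=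
  {ω | 2 * maxIncrement f n ω < ‖d f (n + 1) ω‖₊}.indicator (d f (n + 1))

theorem nnnorm_largeIncrement_le (f : ℕ → Ω → X) (n : ℕ) (ω : Ω) :
    ‖largeIncrement f n ω‖₊ + 2 * maxIncrement f n ω ≤ 2 * maxIncrement f (n + 1) ω := by
  by_cases h : 2 * maxIncrement f n ω < ‖d f (n + 1) ω‖₊
  · rw [largeIncrement, Set.indicator_of_mem (by exact h)]
    calc ‖d f (n + 1) ω‖₊ + 2 * maxIncrement f n ω
        ≤ ‖d f (n + 1) ω‖₊ + ‖d f (n + 1) ω‖₊ := add_le_add le_rfl h.le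
      _ = 2 * ‖d f (n + 1) ω‖₊ := (two_mul _).symm
      _ ≤ _ := mul_le_mul_right (le_max_right _ _) _
  · rw [largeIncrement, Set.indicator_of_notMem (by exact h), nnnorm_zero, zero_add]
    exact mul_le_mul_right (le_max_left _ _) _

theorem tsum_enorm_largeIncrement_le (f : ℕ → Ω → X) (ω : Ω) :
    ∑' n, ‖largeIncrement f n ω‖ₑ ≤ 2 * maximalFn (d f) ω := by
  rw [← terminal_maxIncrement, ENNReal.tsum_eq_iSup_nat]
  refine iSup_le fun n => le_trans ?_
    (mul_le_mul_right (le_iSup (fun n => (maxIncrement f n ω : ℝ≥0∞)) n) _)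
  induction n with
  | zero => simp
  | succ n ih =>
    rw [Finset.sum_range_succ, add_comm]
    refine (add_le_add le_rfl ih).trans ?_
    have h := ENNReal.coe_le_coe.2 (nnnorm_largeIncrement_le f n ω)
    push_cast at h
    exact h

theorem nnnorm_d_sub_largeIncrement_le (f : ℕ → Ω → X) (n : ℕ) (ω : Ω) :
    ‖d f (n + 1) ω - largeIncrement f n ω‖₊ ≤ 2 * maxIncrement f n ω := by
  by_cases h : 2 * maxIncrement f n ω < ‖d f (n + 1) ω‖₊
  · rw [largeIncrement, Set.indicator_of_mem (by exact h)]
    simp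
  · rw [largeIncrement, Set.indicator_of_notMem (by exact h), sub_zero]
    exact not_lt.1 h

variable [NormedSpace ℝ X] [CompleteSpace X] {f : ℕ → Ω → X}

theorem stronglyAdapted_maxIncrement (hf : IsMartingaleFromZero f ℱ μ) :
    StronglyAdapted ℱ (maxIncrement f) := by
  intro n
  induction n with
  | zero => exact stronglyMeasurable_zero
  | succ n ih =>
    exact (continuous_fst.max continuous_snd).comp_stronglyMeasurable
      ((ih.mono (ℱ.mono n.le_succ)).prodMk (hf.stronglyMeasurable_d (n + 1)).nnnorm)

theorem integrable_maxIncrement (hf : IsMartingaleFromZero f ℱ μ) (n : ℕ) :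
    Integrable (fun ω => (maxIncrement f n ω : ℝ)) μ := by
  induction n with
  | zero => simp [maxIncrement]
  | succ n ih =>
    simp only [maxIncrement, NNReal.coe_max, coe_nnnorm]
    exact ih.sup (hf.integrable_d (n + 1)).norm

theorem measurableSet_large (hf : IsMartingaleFromZero f ℱ μ) (n : ℕ) :
    MeasurableSet[ℱ (n + 1)] {ω | 2 * maxIncrement f n ω < ‖d f (n + 1) ω‖₊} :=
  StronglyMeasurable.measurableSet_lt
    (((stronglyAdapted_maxIncrement hf n).mono (ℱ.mono n.le_succ)).const_mul 2)
    (hf.stronglyMeasurable_d (n + 1)).nnnorm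

theorem integrable_largeIncrement (hf : IsMartingaleFromZero f ℱ μ) (n : ℕ) :
    Integrable (largeIncrement f n) μ :=
  (hf.integrable_d (n + 1)).indicator (ℱ.le _ _ (measurableSet_large hf n))

/-- The part of the Davis decomposition of `f` that collects the large increments, compensated to
be a martingale. -/
noncomputable def davisPart (f : ℕ → Ω → X) (ℱ : Filtration ℕ m0) (μ : Measure Ω) : ℕ → Ω → X
  | 0 => 0
  | n + 1 => davisPart f ℱ μ n + (largeIncrement f n - μ[largeIncrement f n | ℱ n])

omit [CompleteSpace X] in
theorem d_davisPart (f : ℕ → Ω → X) (n : ℕ) :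
    d (davisPart f ℱ μ) (n + 1) = largeIncrement f n - μ[largeIncrement f n | ℱ n] := by
  ext ω
  simp [d_succ, davisPart]

theorem isMartingaleFromZero_davisPart [IsFiniteMeasure μ] (hf : IsMartingaleFromZero f ℱ μ) :
    IsMartingaleFromZero (davisPart f ℱ μ) ℱ μ := by
  refine ⟨martingale_of_condExp_sub_eq_zero_nat (fun n => ?_) (fun n => ?_) (fun n => ?_),
    Filter.EventuallyEq.rfl⟩
  · induction n with
    | zero => exact stronglyMeasurable_zero
    | succ n ih =>
      refine (ih.mono (ℱ.mono n.le_succ)).add (StronglyMeasurable.sub ?_ ?_)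
      · exact (hf.stronglyMeasurable_d (n + 1)).indicator (measurableSet_large hf n)
      · exact stronglyMeasurable_condExp.mono (ℱ.mono n.le_succ)
  · induction n with
    | zero => exact integrable_zero _ _ _
    | succ n ih => exact ih.add ((integrable_largeIncrement hf n).sub integrable_condExp)
  · change μ[d (davisPart f ℱ μ) (n + 1) | ℱ n] =ᵐ[μ] 0
    rw [d_davisPart]
    refine (condExp_sub (integrable_largeIncrement hf n) integrable_condExp _).trans ?_
    rw [condExp_of_stronglyMeasurable (ℱ.le n) stronglyMeasurable_condExp integrable_condExp,
      sub_self]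

/-- The increments of the other part of the Davis decomposition are bounded by the increments of
`f` at earlier times: they are compensated small increments. -/
theorem nnnorm_d_sub_davisPart_le [IsFiniteMeasure μ] (hf : IsMartingaleFromZero f ℱ μ) :
    ∀ᵐ ω ∂μ, ∀ n, ‖d (f - davisPart f ℱ μ) (n + 1) ω‖₊ ≤ 4 * maxIncrement f n ω := by
  refine ae_all_iff.2 fun n => ?_
  set s : Ω → X := d f (n + 1) - largeIncrement f n with hs
  have hsint : Integrable s μ := (hf.integrable_d (n + 1)).sub (integrable_largeIncrement hf n)
  have hint2 : Integrable (fun ω => 2 * (maxIncrement f n ω : ℝ)) μ :=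
    (integrable_maxIncrement hf n).const_mul 2
  have hsle : ∀ ω, ‖s ω‖ ≤ 2 * (maxIncrement f n ω : ℝ) := fun ω => by
    exact_mod_cast nnnorm_d_sub_largeIncrement_le f n ω
  have h1 := norm_condExp_le (μ := μ) (m := ℱ n) s
  have h2 : μ[fun ω => ‖s ω‖ | ℱ n] ≤ᵐ[μ] μ[fun ω => 2 * (maxIncrement f n ω : ℝ) | ℱ n] :=
    condExp_mono hsint.norm hint2 (Filter.Eventually.of_forall hsle)
  have h3 : μ[fun ω => 2 * (maxIncrement f n ω : ℝ) | ℱ n] =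
      fun ω => 2 * (maxIncrement f n ω : ℝ) := by
    refine condExp_of_stronglyMeasurable (ℱ.le n) (StronglyMeasurable.const_mul ?_ 2) hint2
    exact NNReal.continuous_coe.comp_stronglyMeasurable (stronglyAdapted_maxIncrement hf n)
  rw [h3] at h2
  filter_upwards [h1, h2, hf.condExp_d n,
    condExp_sub (hf.integrable_d (n + 1)) (integrable_largeIncrement hf n) (ℱ n)]
    with ω h1 h2 h4 h5
  have e : d (f - davisPart f ℱ μ) (n + 1) ω = s ω - (μ[s | ℱ n]) ω := by
    have e1 : d (f - davisPart f ℱ μ) (n + 1) ω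
        = d f (n + 1) ω - d (davisPart f ℱ μ) (n + 1) ω := by
      simp only [d_succ, Pi.sub_apply]; abel
    rw [e1, d_davisPart, hs, h5, Pi.sub_apply, Pi.sub_apply, Pi.sub_apply, h4]
    simp only [Pi.zero_apply]; abel
  rw [e, ← NNReal.coe_le_coe]
  push_cast
  calc ‖s ω - (μ[s | ℱ n]) ω‖ ≤ ‖s ω‖ + ‖(μ[s | ℱ n]) ω‖ := norm_sub_le _ _
    _ ≤ 2 * (maxIncrement f n ω : ℝ) + 2 * (maxIncrement f n ω : ℝ) :=
      add_le_add (hsle ω) (h1.trans h2)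
    _ = _ := by ring

/-- The total variation of the large part of the Davis decomposition is controlled in `L^q` by the
largest increment: the large increments at least double the running maximum, and their compensators
are controlled by the dual Doob inequality. -/
theorem eLpNorm_tsum_enorm_d_davisPart_le [IsFiniteMeasure μ] (hf : IsMartingaleFromZero f ℱ μ)
    {q : ℝ} (hq : 1 ≤ q) :
    eLpNorm (fun ω => ∑' n, ‖d (davisPart f ℱ μ) (n + 1) ω‖ₑ) (ENNReal.ofReal q) μ ≤
      (2 + 2 * ENNReal.ofReal q) * eLpNorm (maximalFn (d f)) (ENNReal.ofReal q) μ := by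
  have hq0 : 0 < q := by linarith
  set a : ℕ → Ω → ℝ≥0∞ := fun n ω => ‖largeIncrement f n ω‖ₑ with ha
  have ham : ∀ n, Measurable (a n) := fun n =>
    ((((hf.stronglyMeasurable_d (n + 1)).mono (ℱ.le _)).indicator
      (ℱ.le _ _ (measurableSet_large hf n)))).enorm
  have hle : ∀ᵐ ω ∂μ, ∑' n, ‖d (davisPart f ℱ μ) (n + 1) ω‖ₑ ≤
      ∑' n, a n ω + ∑' n, (μ⁻[a n | ℱ n]) ω := by
    have h1 : ∀ᵐ ω ∂μ, ∀ n, ‖(μ[largeIncrement f n | ℱ n]) ω‖ₑ ≤ (μ⁻[a n | ℱ n]) ω := by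
      refine ae_all_iff.2 fun n => ?_
      have h2 := condLExp_enorm (ℱ n) (integrable_largeIncrement hf n).norm
        (Filter.Eventually.of_forall fun ω => norm_nonneg _)
      simp only [enorm_norm] at h2
      filter_upwards [norm_condExp_le (μ := μ) (m := ℱ n) (largeIncrement f n), h2] with ω h2 h3
      rw [ha, h3, ← enorm_norm]
      exact enorm_le_iff_norm_le.2 (by simpa using h2.trans (le_abs_self _))
    filter_upwards [h1] with ω h1
    rw [← ENNReal.tsum_add]
    refine ENNReal.tsum_le_tsum fun n => ?_
    rw [d_davisPart, Pi.sub_apply]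
    exact enorm_sub_le.trans (add_le_add le_rfl (h1 n))
  have hA : eLpNorm (fun ω => ∑' n, a n ω) (ENNReal.ofReal q) μ ≤
      2 * eLpNorm (maximalFn (d f)) (ENNReal.ofReal q) μ := by
    refine eLpNorm_le_mul_eLpNorm_of_ae_le_mul' (c := 2) (Filter.Eventually.of_forall fun ω => ?_) _
    exact tsum_enorm_largeIncrement_le f ω
  have hC : eLpNorm (fun ω => ∑' n, (μ⁻[a n | ℱ n]) ω) (ENNReal.ofReal q) μ ≤
      ENNReal.ofReal q * eLpNorm (fun ω => ∑' n, a n ω) (ENNReal.ofReal q) μ := by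
    rw [eLpNorm_ofReal_eq hq0, eLpNorm_ofReal_eq hq0]
    have := ENNReal.rpow_le_rpow (lintegral_tsum_condLExp_rpow_le (ℱ := ℱ) hq ham
      (fun n => (integrable_largeIncrement hf n).2.ne)) (one_div_nonneg.2 hq0.le)
    rwa [ENNReal.mul_rpow_of_nonneg _ _ (one_div_nonneg.2 hq0.le), ← ENNReal.rpow_mul,
      mul_one_div_cancel hq0.ne', ENNReal.rpow_one] at this
  calc eLpNorm (fun ω => ∑' n, ‖d (davisPart f ℱ μ) (n + 1) ω‖ₑ) (ENNReal.ofReal q) μ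
      ≤ eLpNorm ((fun ω => ∑' n, a n ω) + fun ω => ∑' n, (μ⁻[a n | ℱ n]) ω)
          (ENNReal.ofReal q) μ := by
        refine eLpNorm_mono_enorm_ae ?_
        filter_upwards [hle] with ω h using h
    _ ≤ eLpNorm (fun ω => ∑' n, a n ω) (ENNReal.ofReal q) μ +
        eLpNorm (fun ω => ∑' n, (μ⁻[a n | ℱ n]) ω) (ENNReal.ofReal q) μ := by
        refine eLpNorm_add_le ?_ ?_ (by simpa using hq)
        · exact (Measurable.tsum ham).aestronglyMeasurable
        · exact (Measurable.tsum fun n =>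
            measurable_condLExp' _ _ _).aestronglyMeasurable
    _ ≤ _ := by
        refine (add_le_add hA (hC.trans (mul_le_mul_right hA _))).trans (le_of_eq ?_)
        ring

end Davis

/-! ### Extrapolation -/

section Extrapolation

theorem exists_good_lambda_parameter (q : ℝ) {r : ℝ} (hr : 0 < r) (K : ℝ≥0) :
    ∃ δ : ℝ≥0, 0 < δ ∧ δ < 1 ∧
      (K : ℝ≥0∞) * ((4 * δ / (1 - δ) : ℝ≥0) : ℝ≥0∞) ^ r ≤ 2⁻¹ * 2⁻¹ ^ q := by
  set c : ℝ≥0 := 2⁻¹ * 2⁻¹ ^ q with hc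
  have hcpos : 0 < c := mul_pos (by norm_num) (NNReal.rpow_pos (by norm_num))
  set η : ℝ≥0 := (c / (K + 1)) ^ (1 / r) with hη
  have hηpos : 0 < η := NNReal.rpow_pos (div_pos hcpos (by positivity))
  -- `δ` is the solution of `4 δ / (1 - δ) = η`
  have hpos : 0 < 4 + η := by positivity
  have h1 : 1 - η / (4 + η) = 4 / (4 + η) := by
    rw [tsub_eq_iff_eq_add_of_le]
    · rw [← add_div, div_self hpos.ne']
    · exact (div_le_one hpos).2 (le_add_of_nonneg_left (by norm_num))
  refine ⟨η / (4 + η), div_pos hηpos hpos, (div_lt_one hpos).2 (lt_add_of_pos_left _ (by norm_num)),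
    ?_⟩
  have h2 : 4 * (η / (4 + η)) / (1 - η / (4 + η)) = η := by
    rw [h1]; field_simp
  have h3 : K * η ^ r ≤ c := by
    rw [hη, ← NNReal.rpow_mul, one_div_mul_cancel hr.ne', NNReal.rpow_one, mul_div_left_comm]
    refine mul_le_of_le_one_right zero_le ?_
    exact (div_le_one (by positivity)).2 (le_add_of_nonneg_right zero_le_one)
  rw [h2, ← ENNReal.coe_rpow_of_nonneg _ hr.le, ← ENNReal.coe_mul]
  refine (ENNReal.coe_le_coe.2 h3).trans (le_of_eq ?_)
  have h4 : ((2⁻¹ : ℝ≥0) : ℝ≥0∞) = 2⁻¹ := by rw [ENNReal.coe_inv two_ne_zero]; rfl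
  rw [hc, ENNReal.coe_mul, ENNReal.coe_rpow_of_ne_zero (by norm_num), h4]

/-- Extrapolation for martingales whose increments have an adapted bound one step ahead: the moment
form of the good-λ inequality. -/
theorem exists_eLpNorm_le_of_increments_le {q r : ℝ} (K : ℝ≥0) (hq : 1 ≤ q) (hr : 0 < r) :
    ∃ C : ℝ≥0, ∀ (Ω X : Type*) (m0 : MeasurableSpace Ω) (μ : Measure Ω)
      [IsProbabilityMeasure μ] (ℱ : Filtration ℕ m0)
      [NormedAddCommGroup X] [NormedSpace ℝ X] [CompleteSpace X]
      (T U : (ℕ → Ω → X) → ℕ → Ω → ℝ≥0),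
      IsAdmissible T ℱ μ → IsAdmissible U ℱ μ → IsEven U ℱ μ → WeakTypeBound T U ℱ μ r K →
      ∀ (g : ℕ → Ω → X) (w : ℕ → Ω → ℝ≥0), IsMartingaleFromZero g ℱ μ → StronglyAdapted ℱ w →
        (∀ᵐ ω ∂μ, ∀ n, ‖d g (n + 1) ω‖₊ ≤ w n ω) →
        eLpNorm (terminal (T g)) (ENNReal.ofReal q) μ ≤
          C * (eLpNorm (terminal (U g)) (ENNReal.ofReal q) μ +
            eLpNorm (terminal w) (ENNReal.ofReal q) μ) := by
  obtain ⟨δ, hδ0, hδ1, hδ⟩ := exists_good_lambda_parameter q hr K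
  have hq0 : 0 < q := by linarith
  refine ⟨(2 * 2 ^ q) ^ (1 / q) * δ⁻¹, fun Ω X m0 μ _ ℱ _ _ _ T U hT hU hE hW g w hg hw hgw => ?_⟩
  have hTm := hT.measurable_terminal hg
  have hUm := hU.measurable_terminal hg
  have hwm : Measurable (terminal w) := Measurable.iSup fun n =>
    (((hw n).mono (ℱ.le n)).measurable).coe_nnreal_ennreal
  have hmain := lintegral_rpow_le_of_good_lambda (μ := μ) hTm
    (Z := fun ω => (δ⁻¹ : ℝ≥0) * max (terminal (U g) ω) (terminal w ω))
    ((hUm.max hwm).const_mul _) hq0 hδ (fun l hl => ?_)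
  · have h1 : eLpNorm (terminal (T g)) (ENNReal.ofReal q) μ ≤ ((2 * 2 ^ q) ^ (1 / q) : ℝ≥0) *
        eLpNorm (fun ω => (δ⁻¹ : ℝ≥0) * max (terminal (U g) ω) (terminal w ω))
          (ENNReal.ofReal q) μ := by
      rw [eLpNorm_ofReal_eq hq0, eLpNorm_ofReal_eq hq0]
      refine (ENNReal.rpow_le_rpow hmain (one_div_nonneg.2 hq0.le)).trans (le_of_eq ?_)
      rw [ENNReal.mul_rpow_of_nonneg _ _ (one_div_nonneg.2 hq0.le),
        ENNReal.coe_rpow_of_nonneg _ (one_div_nonneg.2 hq0.le), ENNReal.coe_mul,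
        ENNReal.coe_rpow_of_nonneg _ hq0.le]
      rfl
    have h2 : eLpNorm (fun ω => (δ⁻¹ : ℝ≥0) * max (terminal (U g) ω) (terminal w ω))
        (ENNReal.ofReal q) μ ≤ (δ⁻¹ : ℝ≥0) * (eLpNorm (terminal (U g)) (ENNReal.ofReal q) μ +
            eLpNorm (terminal w) (ENNReal.ofReal q) μ) := by
      refine (eLpNorm_le_mul_eLpNorm_of_ae_le_mul' (g := terminal (U g) + terminal w)
        (Filter.Eventually.of_forall fun ω => ?_) _).trans (mul_le_mul_right
          (eLpNorm_add_le hUm.aestronglyMeasurable hwm.aestronglyMeasurable (by simpa using hq)) _)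
      exact mul_le_mul_right (max_le le_self_add le_add_self) _
    refine (h1.trans (mul_le_mul_right h2 _)).trans (le_of_eq ?_)
    rw [ENNReal.coe_mul, mul_assoc]
  · refine (good_lambda hT hU hE hr hW hg hw hgw hl hδ1).trans (add_le_add le_rfl (le_of_eq ?_))
    congr 1
    ext ω
    simp only [Set.mem_ofPred_eq]
    rw [ENNReal.coe_inv hδ0.ne', ← ENNReal.div_eq_inv_mul,
      ENNReal.lt_div_iff_mul_lt (by simp [hδ0.ne']) (by simp), ENNReal.coe_mul, mul_comm]

/-- The extrapolation lemma. The exponent of the weak-type bound may be any positive number. -/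
theorem exists_eLpNorm_terminal_le {q r : ℝ} (K : ℝ≥0) (hq : 1 ≤ q) (hr : 0 < r) :
    ∃ C : ℝ≥0, ∀ (Ω X : Type*) (m0 : MeasurableSpace Ω) (μ : Measure Ω)
      [IsProbabilityMeasure μ] (ℱ : Filtration ℕ m0)
      [NormedAddCommGroup X] [NormedSpace ℝ X] [CompleteSpace X]
      (T U : (ℕ → Ω → X) → ℕ → Ω → ℝ≥0),
      IsAdmissible T ℱ μ → IsAdmissible U ℱ μ → IsEven U ℱ μ → WeakTypeBound T U ℱ μ r K →
      ∀ f : ℕ → Ω → X, IsMartingaleFromZero f ℱ μ →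
        eLpNorm (terminal (T f)) (ENNReal.ofReal q) μ ≤
          C * (eLpNorm (terminal (U f)) (ENNReal.ofReal q) μ +
            eLpNorm (maximalFn (d f)) (ENNReal.ofReal q) μ) := by
  obtain ⟨C, hC⟩ := exists_eLpNorm_le_of_increments_le K hq hr
  have hq1 : 1 ≤ ENNReal.ofReal q := by simpa using hq
  refine ⟨C * (6 + 2 * q.toNNReal) + (2 + 2 * q.toNNReal),
    fun Ω X m0 μ _ ℱ _ _ _ T U hT hU hE hW f hf => ?_⟩
  set h := davisPart f ℱ μ with hh
  have hhm : IsMartingaleFromZero h ℱ μ := isMartingaleFromZero_davisPart hf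
  have hgm : IsMartingaleFromZero (f - h) ℱ μ := hf.sub hhm
  set p := ENNReal.ofReal q with hp
  set D := eLpNorm (maximalFn (d f)) p μ with hD
  set H := eLpNorm (fun ω => ∑' n, ‖d h (n + 1) ω‖ₑ) p μ with hH
  have hHD : H ≤ (2 + 2 * p) * D := eLpNorm_tsum_enorm_d_davisPart_le hf hq
  have hTh : eLpNorm (terminal (T h)) p μ ≤ H :=
    eLpNorm_mono_enorm_ae (hT.terminal_le_tsum hhm)
  have hUh : eLpNorm (terminal (U (-h))) p μ ≤ H := by
    refine eLpNorm_mono_enorm_ae ?_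
    filter_upwards [hU.terminal_le_tsum hhm.neg] with ω hω
    refine hω.trans (le_of_eq (tsum_congr fun n => ?_))
    rw [← enorm_neg]
    congr 1
    simp only [d_succ, Pi.neg_apply]; abel
  have hTf : eLpNorm (terminal (T f)) p μ ≤ eLpNorm (terminal (T (f - h))) p μ + H := by
    refine le_trans ?_ ((eLpNorm_add_le (hT.measurable_terminal hgm).aestronglyMeasurable
      (hT.measurable_terminal hhm).aestronglyMeasurable hq1).trans (add_le_add le_rfl hTh))
    refine eLpNorm_mono_enorm_ae ?_
    have := hT.terminal_add_le hgm hhm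
    rw [sub_add_cancel] at this
    exact this
  have hUg : eLpNorm (terminal (U (f - h))) p μ ≤ eLpNorm (terminal (U f)) p μ + H := by
    refine le_trans ?_ ((eLpNorm_add_le (hU.measurable_terminal hf).aestronglyMeasurable
      (hU.measurable_terminal hhm.neg).aestronglyMeasurable hq1).trans (add_le_add le_rfl hUh))
    refine eLpNorm_mono_enorm_ae ?_
    have := hU.terminal_add_le hf hhm.neg
    rw [← sub_eq_add_neg] at this
    exact this
  have hw : eLpNorm (terminal fun n ω => 4 * maxIncrement f n ω) p μ ≤ 4 * D := by
    refine eLpNorm_le_mul_eLpNorm_of_ae_le_mul' (c := 4) (Filter.Eventually.of_forall fun ω => ?_) _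
    rw [← terminal_maxIncrement]
    refine iSup_le fun n => ?_
    rw [ENNReal.coe_mul]
    exact mul_le_mul_right (le_iSup (fun n => (maxIncrement f n ω : ℝ≥0∞)) n) _
  have hg := hC Ω X m0 μ ℱ T U hT hU hE hW (f - h) (fun n ω => 4 * maxIncrement f n ω) hgm
    (fun n => (stronglyAdapted_maxIncrement hf n).const_mul 4) (nnnorm_d_sub_davisPart_le hf)
  have hpc : p = (q.toNNReal : ℝ≥0∞) := rfl
  set A := eLpNorm (terminal (U f)) p μ
  calc eLpNorm (terminal (T f)) p μ
      ≤ C * ((A + (2 + 2 * p) * D) + 4 * D) + (2 + 2 * p) * D := by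
        refine hTf.trans (add_le_add (hg.trans ?_) hHD)
        exact mul_le_mul_right (add_le_add (hUg.trans (add_le_add le_rfl hHD)) hw) _
    _ ≤ (C * (6 + 2 * p) + (2 + 2 * p)) * (A + D) := by
        have e : (C * (6 + 2 * p) + (2 + 2 * p)) * (A + D) =
            C * ((A + (2 + 2 * p) * D) + 4 * D) + (2 + 2 * p) * D
              + (C * (5 + 2 * p) * A + (2 + 2 * p) * A) := by ring
        rw [e]
        exact le_self_add
    _ = _ := by
        rw [hpc]; push_cast; rfl

end Extrapolation

/-! ### Operators given by functionals of paths -/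

section PathFunctional

/-- A functional of paths, evaluated along time. This is the pathwise counterpart of
`IsAdmissible` and `IsEven`; `congr` says that the value at time `n` depends on the path up to time
`n` only, which makes the functional compatible with stopping. -/
structure IsPathFunctional {X : Type*} [NormedAddCommGroup X] [MeasurableSpace X]
    (Φ : (ℕ → X) → ℕ → ℝ≥0) : Prop where
  measurable : ∀ n, Measurable fun x => Φ x n
  congr : ∀ x y n, (∀ k ≤ n, x k = y k) → Φ x n = Φ y n
  zero : ∀ x, x 0 = 0 → Φ x 0 = 0
  mono : ∀ x, Monotone (Φ x)
  add_le : ∀ x y n, Φ (x + y) n ≤ Φ x n + Φ y n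
  neg : ∀ x n, Φ (-x) n = Φ x n
  growth : ∀ x n, Φ x (n + 1) ≤ Φ x n + ‖x (n + 1) - x n‖₊

/-- The operator on processes that applies a functional to each path. -/
def pathOperator {Ω X : Type*} (Φ : (ℕ → X) → ℕ → ℝ≥0) (f : ℕ → Ω → X) (n : ℕ) (ω : Ω) : ℝ≥0 :=
  Φ (fun k => f k ω) n

namespace IsPathFunctional

variable {Ω X : Type*} {m0 : MeasurableSpace Ω} {μ : Measure Ω} {ℱ : Filtration ℕ m0}
  [NormedAddCommGroup X] [MeasurableSpace X] {Φ : (ℕ → X) → ℕ → ℝ≥0}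

theorem isAdmissible [NormedSpace ℝ X] [CompleteSpace X] [BorelSpace X]
    (hΦ : IsPathFunctional Φ) : IsAdmissible (X := X) (pathOperator Φ) ℱ μ where
  adapted f hf n := by
    have h : pathOperator Φ f n = (fun x => Φ x n) ∘ fun ω k => f (min k n) ω := by
      ext ω
      refine congrArg NNReal.toReal (hΦ.congr _ _ n fun k hk => ?_)
      simp only [min_eq_left hk]
    have hm : Measurable[ℱ n] fun ω (k : ℕ) => f (min k n) ω :=
      @measurable_pi_lambda _ _ _ (ℱ n) _ _ fun k =>
        ((hf.1.1 (min k n)).mono (ℱ.mono (min_le_right k n))).measurable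
    rw [h]
    exact ((hΦ.measurable n).comp hm).stronglyMeasurable
  zero f hf := by
    filter_upwards [hf.2] with ω hω
    exact hΦ.zero _ hω
  increasing f _ n := Filter.Eventually.of_forall fun ω => hΦ.mono _ n.le_succ
  subadditive f g _ _ n := Filter.Eventually.of_forall fun ω =>
    hΦ.add_le (fun k => f k ω) (fun k => g k ω) n
  stopping f _ τ _ := by
    refine Filter.Eventually.of_forall fun ω => ?_
    obtain h | ⟨n, h⟩ := eq_top_or_eq_coe (τ ω)
    · simp only [valueAt_of_eq_top h, terminal, pathOperator]
      have : ∀ k, stoppedProcess f τ k ω = f k ω := fun k =>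
        stoppedProcess_of_le (by rw [h]; exact le_top)
      simp only [this]
    · simp only [valueAt_of_eq_coe h, pathOperator]
      refine congrArg _ (hΦ.congr _ _ n fun k hk => (stoppedProcess_of_le ?_).symm)
      rw [h]; exact Nat.cast_le.2 hk
  growth f _ n := Filter.Eventually.of_forall fun ω => hΦ.growth _ n

theorem isEven [NormedSpace ℝ X] [CompleteSpace X] (hΦ : IsPathFunctional Φ) :
    IsEven (X := X) (pathOperator Φ) ℱ μ :=
  fun _ _ n => Filter.Eventually.of_forall fun _ => hΦ.neg _ n

end IsPathFunctional

/-- A functional that dominates the increments of the path dominates the largest increment. -/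
theorem maximalFn_d_le_terminal {Ω X : Type*} [NormedAddCommGroup X] {Φ : (ℕ → X) → ℕ → ℝ≥0}
    (hΦ : ∀ x n, ‖x (n + 1) - x n‖₊ ≤ Φ x (n + 1)) (f : ℕ → Ω → X) (ω : Ω) :
    maximalFn (d f) ω ≤ terminal (pathOperator Φ f) ω := by
  refine iSup_le fun n => ?_
  cases n with
  | zero => simp
  | succ n =>
    refine le_trans ?_ (le_iSup (fun n => (pathOperator Φ f n ω : ℝ≥0∞)) (n + 1))
    exact ENNReal.coe_le_coe.2 (hΦ (fun k => f k ω) n)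

section MaxSquare

variable {X : Type*} [NormedAddCommGroup X]

/-- The running maximum of a path. -/
noncomputable def runningMax (x : ℕ → X) : ℕ → ℝ≥0
  | 0 => ‖x 0‖₊
  | n + 1 => max (runningMax x n) ‖x (n + 1)‖₊

theorem nnnorm_le_runningMax (x : ℕ → X) (n : ℕ) : ‖x n‖₊ ≤ runningMax x n := by
  cases n with
  | zero => exact le_rfl
  | succ n => exact le_max_right _ _

theorem runningMax_mono (x : ℕ → X) : Monotone (runningMax x) :=
  monotone_nat_of_le_succ fun _ => le_max_left _ _

theorem runningMax_le {x : ℕ → X} {n : ℕ} {c : ℝ≥0} (h : ∀ k ≤ n, ‖x k‖₊ ≤ c) :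
    runningMax x n ≤ c := by
  induction n with
  | zero => exact h 0 le_rfl
  | succ n ih => exact max_le (ih fun k hk => h k (hk.trans n.le_succ)) (h _ le_rfl)

theorem nnnorm_le_runningMax_of_le (x : ℕ → X) {k n : ℕ} (h : k ≤ n) :
    ‖x k‖₊ ≤ runningMax x n :=
  (nnnorm_le_runningMax x k).trans (runningMax_mono x h)

theorem isPathFunctional_runningMax [MeasurableSpace X] [OpensMeasurableSpace X] :
    IsPathFunctional (runningMax : (ℕ → X) → ℕ → ℝ≥0) where
  measurable n := by
    induction n with
    | zero => exact (measurable_pi_apply 0).nnnorm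
    | succ n ih => exact ih.max (measurable_pi_apply (n + 1)).nnnorm
  congr x y n h := by
    refine le_antisymm (runningMax_le fun k hk => ?_) (runningMax_le fun k hk => ?_)
    · rw [h k hk]; exact nnnorm_le_runningMax_of_le y hk
    · rw [← h k hk]; exact nnnorm_le_runningMax_of_le x hk
  zero x h := by simp [runningMax, h]
  mono := runningMax_mono
  add_le x y n := runningMax_le fun k hk => (nnnorm_add_le _ _).trans
    (add_le_add (nnnorm_le_runningMax_of_le x hk) (nnnorm_le_runningMax_of_le y hk))
  neg x n := by
    refine le_antisymm (runningMax_le fun k hk => ?_) (runningMax_le fun k hk => ?_)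
    · rw [Pi.neg_apply, nnnorm_neg]; exact nnnorm_le_runningMax_of_le x hk
    · rw [← nnnorm_neg]; exact nnnorm_le_runningMax_of_le (-x) hk
  growth x n := by
    refine max_le le_self_add ?_
    calc ‖x (n + 1)‖₊ = ‖x n + (x (n + 1) - x n)‖₊ := by rw [add_sub_cancel]
      _ ≤ ‖x n‖₊ + ‖x (n + 1) - x n‖₊ := nnnorm_add_le _ _
      _ ≤ _ := add_le_add (nnnorm_le_runningMax x n) le_rfl

/-- The running square function of a path. -/
noncomputable def runningSquare (x : ℕ → X) (n : ℕ) : ℝ≥0 :=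
  (∑ k ∈ Finset.range n, ‖x (k + 1) - x k‖₊ ^ (2 : ℝ)) ^ (1 / 2 : ℝ)

theorem isPathFunctional_runningSquare [MeasurableSpace X] [OpensMeasurableSpace X]
    [MeasurableSub₂ X] : IsPathFunctional (runningSquare : (ℕ → X) → ℕ → ℝ≥0) where
  measurable n := by
    refine Measurable.pow_const (Finset.measurable_sum _ fun k _ => Measurable.pow_const ?_ _) _
    exact ((measurable_pi_apply (k + 1)).sub (measurable_pi_apply k)).nnnorm
  congr x y n h := by
    unfold runningSquare
    congr 1
    refine Finset.sum_congr rfl fun k hk => ?_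
    have hk := Finset.mem_range.1 hk
    rw [h (k + 1) hk, h k hk.le]
  zero x _ := by simp [runningSquare]
  mono x m n h := by
    refine NNReal.rpow_le_rpow ?_ (by norm_num)
    exact Finset.sum_le_sum_of_subset (Finset.range_subset_range.2 h)
  add_le x y n := by
    refine le_trans (NNReal.rpow_le_rpow (Finset.sum_le_sum fun k _ => ?_) (by norm_num))
      (NNReal.Lp_add_le (Finset.range n) (fun k => ‖x (k + 1) - x k‖₊)
        (fun k => ‖y (k + 1) - y k‖₊) one_le_two)
    refine NNReal.rpow_le_rpow ?_ (by norm_num)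
    simp only [Pi.add_apply]
    rw [add_sub_add_comm]
    exact nnnorm_add_le _ _
  neg x n := by
    unfold runningSquare
    congr 1
    refine Finset.sum_congr rfl fun k _ => ?_
    simp only [Pi.neg_apply]
    rw [← nnnorm_neg]
    congr 2
    abel
  growth x n := by
    have h := NNReal.rpow_add_rpow_le_add (p := 2) (runningSquare x n) ‖x (n + 1) - x n‖₊ one_le_two
    refine le_trans (le_of_eq ?_) h
    unfold runningSquare
    rw [Finset.sum_range_succ, ← NNReal.rpow_mul]
    norm_num

theorem nnnorm_sub_le_runningSquare (x : ℕ → X) (n : ℕ) :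
    ‖x (n + 1) - x n‖₊ ≤ runningSquare x (n + 1) := by
  have h : ‖x (n + 1) - x n‖₊ = (‖x (n + 1) - x n‖₊ ^ (2 : ℝ)) ^ (1 / 2 : ℝ) := by
    rw [← NNReal.rpow_mul]; norm_num
  rw [h]
  refine NNReal.rpow_le_rpow ?_ (by norm_num)
  exact Finset.single_le_sum (f := fun k => ‖x (k + 1) - x k‖₊ ^ (2 : ℝ)) (fun _ _ => zero_le)
    (Finset.mem_range.2 n.lt_succ_self)

theorem terminal_runningMax {Ω : Type*} (f : ℕ → Ω → X) :
    terminal (pathOperator runningMax f) = maximalFn f := by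
  ext ω
  refine le_antisymm (iSup_le fun n => ?_) (iSup_mono fun n => ?_)
  · unfold pathOperator
    induction n with
    | zero => exact le_iSup (fun n => ‖f n ω‖ₑ) 0
    | succ n ih =>
      rw [runningMax, ENNReal.coe_max]
      exact max_le ih (le_iSup (fun n => ‖f n ω‖ₑ) (n + 1))
  · exact ENNReal.coe_le_coe.2 (nnnorm_le_runningMax (fun k => f k ω) n)

theorem terminal_runningSquare {Ω : Type*} (f : ℕ → Ω → X) :
    terminal (pathOperator runningSquare f) = squareFn f := by
  ext ω
  have h : ∑' n, ‖d f n ω‖ₑ ^ (2 : ℝ) = ∑' n, ‖d f (n + 1) ω‖ₑ ^ (2 : ℝ) := by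
    rw [tsum_eq_zero_add' ENNReal.summable]
    simp
  rw [squareFn, h, ENNReal.tsum_eq_iSup_nat, ← ENNReal.orderIsoRpow_apply _ (by norm_num),
    OrderIso.map_iSup]
  refine iSup_congr fun n => ?_
  rw [ENNReal.orderIsoRpow_apply, pathOperator, runningSquare,
    ENNReal.coe_rpow_of_nonneg _ (by norm_num)]
  congr 1
  push_cast
  refine Finset.sum_congr rfl fun k _ => ?_
  rw [ENNReal.coe_rpow_of_nonneg _ (by norm_num)]
  rfl

end MaxSquare

section PiLp

variable {N : ℕ} {p : ℝ≥0∞} [hp1 : Fact (1 ≤ p)]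

/-- The `ℓ^p` norm of the values of a functional of real paths on the coordinates of a path in
`ℓ^p_N`. -/
noncomputable def coordFunctional (p : ℝ≥0∞) (Φ : (ℕ → ℝ) → ℕ → ℝ≥0)
    (x : ℕ → PiLp p fun _ : Fin N => ℝ) (n : ℕ) : ℝ≥0 :=
  (∑ i, Φ (fun k => x k i) n ^ p.toReal) ^ (1 / p.toReal)

omit hp1 in
theorem coordFunctional_mono_of_le {Φ Ψ : (ℕ → ℝ) → ℕ → ℝ≥0}
    {x y : ℕ → PiLp p fun _ : Fin N => ℝ} {m n : ℕ}
    (h : ∀ i, Φ (fun k => x k i) m ≤ Ψ (fun k => y k i) n) :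
    coordFunctional p Φ x m ≤ coordFunctional p Ψ y n :=
  NNReal.rpow_le_rpow (Finset.sum_le_sum fun i _ => NNReal.rpow_le_rpow (h i)
    ENNReal.toReal_nonneg) (one_div_nonneg.2 ENNReal.toReal_nonneg)

theorem one_le_toReal (hp : p ≠ ∞) : 1 ≤ p.toReal := by
  rw [← ENNReal.toReal_one]
  exact ENNReal.toReal_mono hp hp1.out

theorem isPathFunctional_coordFunctional (hp : p ≠ ∞) {Φ : (ℕ → ℝ) → ℕ → ℝ≥0}
    (hΦ : IsPathFunctional Φ) :
    IsPathFunctional (coordFunctional (N := N) p Φ) where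
  measurable n := by
    refine Measurable.pow_const (Finset.measurable_sum _ fun i _ => Measurable.pow_const ?_ _) _
    refine (hΦ.measurable n).comp (measurable_pi_lambda _ fun k => ?_)
    have h : Measurable fun x : PiLp p fun _ : Fin N => ℝ => x i :=
      (PiLp.continuous_apply p (fun _ : Fin N => ℝ) i).measurable
    exact h.comp (measurable_pi_apply k)
  congr x y n h := by
    have : ∀ i, Φ (fun k => x k i) n = Φ (fun k => y k i) n := fun i =>
      hΦ.congr _ _ n fun k hk => by rw [h k hk]
    simp only [coordFunctional, this]
  zero x h := by
    have hp0 : 0 < p.toReal := by linarith [one_le_toReal hp]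
    have : ∀ i, Φ (fun k => x k i) 0 = 0 := fun i => hΦ.zero _ (by simp [h])
    simp [coordFunctional, this, hp0.ne']
  mono x m n h := coordFunctional_mono_of_le fun i => hΦ.mono _ h
  add_le x y n := by
    refine le_trans ?_ (NNReal.Lp_add_le Finset.univ _ _ (one_le_toReal hp))
    refine NNReal.rpow_le_rpow (Finset.sum_le_sum fun i _ => NNReal.rpow_le_rpow ?_
      ENNReal.toReal_nonneg) (one_div_nonneg.2 ENNReal.toReal_nonneg)
    exact hΦ.add_le (fun k => x k i) (fun k => y k i) n
  neg x n := by
    have : ∀ i, Φ (fun k => (-x) k i) n = Φ (fun k => x k i) n := fun i =>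
      hΦ.neg (fun k => x k i) n
    simp only [coordFunctional, this]
  growth x n := by
    rw [PiLp.nnnorm_eq_sum hp]
    refine le_trans ?_ (NNReal.Lp_add_le Finset.univ _ _ (one_le_toReal hp))
    refine NNReal.rpow_le_rpow (Finset.sum_le_sum fun i _ => NNReal.rpow_le_rpow ?_
      ENNReal.toReal_nonneg) (one_div_nonneg.2 ENNReal.toReal_nonneg)
    exact hΦ.growth (fun k => x k i) n

theorem nnnorm_sub_le_coordFunctional (hp : p ≠ ∞) {Φ : (ℕ → ℝ) → ℕ → ℝ≥0}
    (hΦ : ∀ x n, ‖x (n + 1) - x n‖₊ ≤ Φ x (n + 1)) (x : ℕ → PiLp p fun _ : Fin N => ℝ) (n : ℕ) :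
    ‖x (n + 1) - x n‖₊ ≤ coordFunctional p Φ x (n + 1) := by
  rw [PiLp.nnnorm_eq_sum hp]
  refine NNReal.rpow_le_rpow (Finset.sum_le_sum fun i _ => NNReal.rpow_le_rpow ?_
    ENNReal.toReal_nonneg) (one_div_nonneg.2 ENNReal.toReal_nonneg)
  exact hΦ (fun k => x k i) n

theorem terminal_coordFunctional (hp : p ≠ ∞) {Φ : (ℕ → ℝ) → ℕ → ℝ≥0} (hΦ : IsPathFunctional Φ)
    {Ω : Type*} (f : ℕ → Ω → PiLp p fun _ : Fin N => ℝ) (ω : Ω) :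
    terminal (pathOperator (coordFunctional p Φ) f) ω =
      (∑ i, terminal (pathOperator Φ fun n ω => f n ω i) ω ^ p.toReal) ^ (1 / p.toReal) := by
  have hp0 : 0 < p.toReal := by linarith [one_le_toReal hp]
  have h1 : ∀ i, terminal (pathOperator Φ fun n ω => f n ω i) ω ^ p.toReal =
      ⨆ n, ((Φ (fun k => f k ω i) n ^ p.toReal : ℝ≥0) : ℝ≥0∞) := fun i => by
    rw [terminal, ← ENNReal.orderIsoRpow_apply _ hp0, OrderIso.map_iSup]
    refine iSup_congr fun n => ?_
    rw [ENNReal.orderIsoRpow_apply, ENNReal.coe_rpow_of_nonneg _ hp0.le]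
    rfl
  simp only [h1]
  have h2 : ∀ i : Fin N, Monotone fun n =>
      ((Φ (fun k => f k ω i) n ^ p.toReal : ℝ≥0) : ℝ≥0∞) := fun i m n h =>
    ENNReal.coe_le_coe.2 (NNReal.rpow_le_rpow (hΦ.mono _ h) hp0.le)
  rw [ENNReal.finsetSum_iSup_of_monotone h2,
    ← ENNReal.orderIsoRpow_apply _ (one_div_pos.2 hp0), OrderIso.map_iSup]
  refine iSup_congr fun n => ?_
  rw [ENNReal.orderIsoRpow_apply, pathOperator, coordFunctional,
    ENNReal.coe_rpow_of_nonneg _ (one_div_nonneg.2 hp0.le)]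
  push_cast
  rfl

end PiLp

end PathFunctional

/-! ### The scalar and the vector-valued Burkholder-Davis-Gundy inequalities -/

section Scalar

variable {Ω : Type*} {m0 : MeasurableSpace Ω} {μ : Measure Ω} {ℱ : Filtration ℕ m0}

/-- Orthogonality of martingale increments. If the right-hand side is finite, then `f (n + 1)` is
square integrable, and the mixed term has integral zero. -/
theorem lintegral_enorm_sq_succ_le [IsFiniteMeasure μ] {f : ℕ → Ω → ℝ}
    (hf : IsMartingaleFromZero f ℱ μ) (n : ℕ) :
    ∫⁻ ω, ‖f (n + 1) ω‖ₑ ^ (2 : ℝ) ∂μ ≤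
      ∫⁻ ω, ‖f n ω‖ₑ ^ (2 : ℝ) ∂μ + ∫⁻ ω, ‖d f (n + 1) ω‖ₑ ^ (2 : ℝ) ∂μ := by
  have key : ∀ g : Ω → ℝ, AEStronglyMeasurable g μ → ∫⁻ ω, ‖g ω‖ₑ ^ (2 : ℝ) ∂μ ≠ ∞ →
      MemLp g 2 μ := fun g hg h => by
    refine ⟨hg, ?_⟩
    rw [eLpNorm_lt_top_iff_lintegral_rpow_enorm_lt_top (by simp) (by simp)]
    simpa using h.lt_top
  have hsq : ∀ g : Ω → ℝ, MemLp g 2 μ →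
      ∫⁻ ω, ‖g ω‖ₑ ^ (2 : ℝ) ∂μ = ENNReal.ofReal (∫ ω, g ω ^ 2 ∂μ) := fun g hg => by
    rw [ofReal_integral_eq_lintegral_ofReal hg.integrable_sq
      (Filter.Eventually.of_forall fun ω => sq_nonneg _)]
    refine lintegral_congr fun ω => ?_
    rw [Real.enorm_eq_ofReal_abs, ENNReal.ofReal_rpow_of_nonneg (abs_nonneg _) (by norm_num)]
    norm_num
  by_cases h1 : ∫⁻ ω, ‖f n ω‖ₑ ^ (2 : ℝ) ∂μ = ∞
  · rw [h1]; simp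
  by_cases h2 : ∫⁻ ω, ‖d f (n + 1) ω‖ₑ ^ (2 : ℝ) ∂μ = ∞
  · rw [h2]; simp
  have m1 := key _ (hf.1.integrable n).1 h1
  have m2 := key _ (hf.integrable_d (n + 1)).1 h2
  have e : f (n + 1) = f n + d f (n + 1) := by
    ext ω; simp [d_succ]
  have m3 : MemLp (f (n + 1)) 2 μ := e ▸ m1.add m2
  have hmul : Integrable (f n * d f (n + 1)) μ := m1.integrable_mul m2
  have hzero : ∫ ω, (f n * d f (n + 1)) ω ∂μ = 0 := by
    have h3 := condExp_mul_of_stronglyMeasurable_left (hf.1.1 n) hmul (hf.integrable_d (n + 1))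
    rw [← integral_condExp (ℱ.le n)]
    refine integral_eq_zero_of_ae ?_
    filter_upwards [h3, hf.condExp_d n] with ω h3 h4
    rw [h3, Pi.mul_apply, h4]
    simp
  have hint : ∫ ω, f (n + 1) ω ^ 2 ∂μ =
      ∫ ω, f n ω ^ 2 ∂μ + ∫ ω, d f (n + 1) ω ^ 2 ∂μ := by
    have e2 : ∀ ω, f (n + 1) ω ^ 2 =
        (f n ω ^ 2 + d f (n + 1) ω ^ 2) + 2 * (f n * d f (n + 1)) ω := fun ω => by
      rw [e]; simp only [Pi.add_apply, Pi.mul_apply]; ring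
    simp_rw [e2]
    have hadd : Integrable (fun ω => f n ω ^ 2 + d f (n + 1) ω ^ 2) μ :=
      m1.integrable_sq.add m2.integrable_sq
    rw [integral_add hadd (hmul.const_mul 2),
      integral_add m1.integrable_sq m2.integrable_sq, integral_const_mul, hzero]
    ring
  rw [hsq _ m1, hsq _ m2, hsq _ m3, hint]
  exact ENNReal.ofReal_add_le

theorem lintegral_enorm_sq_le_sum [IsFiniteMeasure μ] {f : ℕ → Ω → ℝ}
    (hf : IsMartingaleFromZero f ℱ μ) (n : ℕ) :
    ∫⁻ ω, ‖f n ω‖ₑ ^ (2 : ℝ) ∂μ ≤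
      ∑ k ∈ Finset.range n, ∫⁻ ω, ‖d f (k + 1) ω‖ₑ ^ (2 : ℝ) ∂μ := by
  induction n with
  | zero =>
    have : ∫⁻ ω, ‖f 0 ω‖ₑ ^ (2 : ℝ) ∂μ = 0 := by
      rw [lintegral_congr_ae (g := fun _ => 0) ?_, lintegral_zero]
      filter_upwards [hf.2] with ω hω
      simp [hω]
    rw [this]; exact zero_le
  | succ n ih =>
    rw [Finset.sum_range_succ]
    exact (lintegral_enorm_sq_succ_le hf n).trans (add_le_add ih le_rfl)

/-- Kolmogorov's inequality with the square function on the right-hand side: on the event that `|f|`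
exceeds the level `t` by time `n`, the martingale stopped at that moment has absolute value above
`t` at time `n`. -/
theorem weakTypeBound_runningMax_runningSquare [IsProbabilityMeasure μ] :
    WeakTypeBound (X := ℝ) (pathOperator runningMax) (pathOperator runningSquare) ℱ μ 2 1 := by
  intro f hf t ht
  have hrhs : eLpNorm (terminal (pathOperator runningSquare f)) (ENNReal.ofReal 2) μ ^ (2 : ℝ) =
      ∫⁻ ω, ∑' n, ‖d f n ω‖ₑ ^ (2 : ℝ) ∂μ := by
    rw [eLpNorm_ofReal_rpow two_pos, terminal_runningSquare]
    refine lintegral_congr fun ω => ?_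
    rw [squareFn, ← ENNReal.rpow_mul]
    norm_num
  rw [hrhs]
  set J := ∫⁻ ω, ∑' n, ‖d f n ω‖ₑ ^ (2 : ℝ) ∂μ with hJ
  set a : ℝ≥0 := t.toNNReal with ha
  have hapos : 0 < a := Real.toNNReal_pos.2 ht
  set A : ℕ → Ω → ℝ≥0 := fun n ω => ‖f n ω‖₊ with hA
  set σ := hittingAfter A (Set.Ioi a) 0 with hσdef
  have hσ : IsStoppingTime ℱ σ :=
    isStoppingTime_hittingAfter_Ioi (fun n => (hf.1.1 n).nnnorm) a
  have hgm := hf.stopped hσ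
  set g := stoppedProcess f σ with hg
  have hset : {ω | ENNReal.ofReal t < terminal (pathOperator runningMax f) ω} =
      ⋃ n : ℕ, {ω | σ ω ≤ n} := by
    ext ω
    have h1 : terminal A ω = maximalFn f ω := rfl
    have h2 : σ ω = ⊤ ↔ terminal A ω ≤ a := hittingAfter_eq_top_iff_terminal_le
    rw [Set.mem_ofPred_eq, terminal_runningMax, ← h1, ← not_le]
    change ¬ (terminal A ω ≤ a) ↔ _
    rw [← h2, Set.mem_iUnion]
    obtain h | ⟨k, h⟩ := eq_top_or_eq_coe (σ ω)
    · simp only [h, not_true, false_iff, not_exists]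
      intro n hn
      have hn : σ ω ≤ n := hn
      rw [h, top_le_iff] at hn
      exact absurd hn (WithTop.coe_ne_top (a := n))
    · rw [h]
      exact iff_of_true (WithTop.coe_ne_top (a := k)) ⟨k, h.le⟩
  have hmono : Monotone fun n : ℕ => {ω | σ ω ≤ n} := fun m n hmn ω hω =>
    le_trans (show σ ω ≤ m from hω) (Nat.cast_le.2 hmn)
  have hn : ∀ n : ℕ, μ {ω | σ ω ≤ n} ≤ ENNReal.ofReal (t ^ (-2 : ℝ)) * J := by
    intro n
    have hle : ∀ ω, σ ω ≤ n → (a : ℝ≥0∞) ≤ ‖g n ω‖ₑ := by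
      intro ω hω
      obtain h | ⟨k, h⟩ := eq_top_or_eq_coe (σ ω)
      · rw [h, top_le_iff] at hω
        exact absurd hω (WithTop.coe_ne_top (a := n))
      · have hk : k ≤ n := by rw [h] at hω; exact Nat.cast_le.1 hω
        have hne : σ ω ≠ ⊤ := by rw [h]; exact WithTop.coe_ne_top (a := k)
        have hmem := hittingAfter_mem_set_of_ne_top hne
        have hunt : (σ ω).untopA = k := by rw [h]; rfl
        change a < A (σ ω).untopA ω at hmem
        rw [hunt] at hmem
        rw [hg, stoppedProcess_of_eq_coe h hk]
        exact ENNReal.coe_le_coe.2 hmem.le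
    have hg2 : ∫⁻ ω, ‖g n ω‖ₑ ^ (2 : ℝ) ∂μ ≤ J := by
      refine (lintegral_enorm_sq_le_sum hgm n).trans ?_
      rw [← lintegral_finsetSum _ fun k _ =>
        ((hgm.stronglyMeasurable_d (k + 1)).mono (ℱ.le _)).enorm.pow_const _]
      refine lintegral_mono fun ω => ?_
      calc ∑ k ∈ Finset.range n, ‖d g (k + 1) ω‖ₑ ^ (2 : ℝ)
          ≤ ∑ k ∈ Finset.range n, ‖d f (k + 1) ω‖ₑ ^ (2 : ℝ) := by
            refine Finset.sum_le_sum fun k _ => ENNReal.rpow_le_rpow ?_ zero_le_two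
            rw [hg, d_stoppedProcess]
            exact enorm_indicator_le_enorm_self _ _
        _ ≤ ∑' k, ‖d f (k + 1) ω‖ₑ ^ (2 : ℝ) := ENNReal.sum_le_tsum _
        _ ≤ _ := ENNReal.tsum_comp_le_tsum_of_injective (add_left_injective 1) _
    have hmarkov := mul_meas_ge_le_lintegral (μ := μ) (f := fun ω => ‖g n ω‖ₑ ^ (2 : ℝ))
      (((hgm.1.1 n).mono (ℱ.le n)).enorm.pow_const _) ((a : ℝ≥0∞) ^ (2 : ℝ))
    have hpow0 : (a : ℝ≥0∞) ^ (2 : ℝ) ≠ 0 := by simp [hapos.ne']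
    have hpowt : (a : ℝ≥0∞) ^ (2 : ℝ) ≠ ∞ := by simp
    have e : ENNReal.ofReal (t ^ (-2 : ℝ)) = ((a : ℝ≥0∞) ^ (2 : ℝ))⁻¹ := by
      rw [← ENNReal.rpow_neg, ← ENNReal.ofReal_rpow_of_pos ht]
      rfl
    rw [e, ← ENNReal.div_eq_inv_mul, ENNReal.le_div_iff_mul_le (Or.inl hpow0) (Or.inl hpowt),
      mul_comm]
    refine (mul_le_mul_right (measure_mono fun ω hω => ?_) _).trans (hmarkov.trans hg2)
    exact ENNReal.rpow_le_rpow (hle ω hω) zero_le_two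
  rw [hset, hmono.measure_iUnion, ENNReal.coe_one, one_mul]
  exact iSup_le hn

/-- The scalar Burkholder-Davis-Gundy inequality (one half), by extrapolation from `L^2`. -/
theorem exists_eLpNorm_maximalFn_le_squareFn {q : ℝ} (hq : 1 ≤ q) :
    ∃ C : ℝ≥0, ∀ (Ω : Type*) (m0 : MeasurableSpace Ω) (μ : Measure Ω)
      [IsProbabilityMeasure μ] (ℱ : Filtration ℕ m0) (f : ℕ → Ω → ℝ),
      IsMartingaleFromZero f ℱ μ →
        eLpNorm (maximalFn f) (ENNReal.ofReal q) μ ≤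
          C * eLpNorm (squareFn f) (ENNReal.ofReal q) μ := by
  obtain ⟨C, hC⟩ := exists_eLpNorm_terminal_le 1 hq two_pos
  refine ⟨2 * C, fun Ω m0 μ _ ℱ f hf => ?_⟩
  have h := hC Ω ℝ m0 μ ℱ (pathOperator runningMax) (pathOperator runningSquare)
    isPathFunctional_runningMax.isAdmissible isPathFunctional_runningSquare.isAdmissible
    isPathFunctional_runningSquare.isEven weakTypeBound_runningMax_runningSquare f hf
  rw [terminal_runningMax, terminal_runningSquare] at h
  have hd : eLpNorm (maximalFn (d f)) (ENNReal.ofReal q) μ ≤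
      eLpNorm (squareFn f) (ENNReal.ofReal q) μ := by
    refine eLpNorm_mono_enorm fun ω => ?_
    rw [← terminal_runningSquare]
    exact maximalFn_d_le_terminal nnnorm_sub_le_runningSquare f ω
  refine (h.trans (mul_le_mul_right (add_le_add le_rfl hd) _)).trans (le_of_eq ?_)
  push_cast
  ring

end Scalar

section Vector

variable {Ω : Type*} {m0 : MeasurableSpace Ω} {μ : Measure Ω} {ℱ : Filtration ℕ m0}

theorem IsMartingaleFromZero.coord [IsFiniteMeasure μ] {N : ℕ} {p : ℝ≥0∞} [Fact (1 ≤ p)]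
    {f : ℕ → Ω → PiLp p fun _ : Fin N => ℝ} (hf : IsMartingaleFromZero f ℱ μ) (i : Fin N) :
    IsMartingaleFromZero (fun n ω => f n ω i) ℱ μ := by
  refine ⟨⟨fun n => (PiLp.continuous_apply p (fun _ : Fin N => ℝ) i).comp_stronglyMeasurable
    (hf.1.1 n), fun m n hmn => ?_⟩, ?_⟩
  · have h := (PiLp.proj (𝕜 := ℝ) p (fun _ : Fin N => ℝ) i).comp_condExp_comm (m := ℱ m)
      (hf.1.integrable n)
    filter_upwards [h, hf.1.2 m n hmn] with ω h1 h2
    change (μ[(PiLp.proj (𝕜 := ℝ) p (fun _ : Fin N => ℝ) i) ∘ f n | ℱ m]) ω = _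
    rw [← h1, Function.comp_apply, h2]
    rfl
  · filter_upwards [hf.2] with ω hω
    simp [hω]

theorem isMartingaleFromZero_toLp [IsFiniteMeasure μ] {N : ℕ} (p : ℝ≥0∞) [Fact (1 ≤ p)]
    {f : Fin N → ℕ → Ω → ℝ} (hf : ∀ i, IsMartingaleFromZero (f i) ℱ μ) :
    IsMartingaleFromZero
      (fun n ω => (WithLp.toLp p fun i => f i n ω : PiLp p fun _ : Fin N => ℝ)) ℱ μ := by
  have hint : ∀ n, Integrable
      (fun ω => (WithLp.toLp p fun i => f i n ω : PiLp p fun _ : Fin N => ℝ)) μ := fun n =>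
    Integrable.of_eval_piLp fun i => (hf i).1.integrable n
  refine ⟨⟨fun n => ?_, fun m n hmn => ?_⟩, ?_⟩
  · have h : Measurable[ℱ n] fun ω i => f i n ω :=
      @measurable_pi_lambda _ _ _ (ℱ n) _ _ fun i => ((hf i).1.1 n).measurable
    exact (PiLp.continuous_toLp p (fun _ : Fin N => ℝ)).comp_stronglyMeasurable h.stronglyMeasurable
  · have h : ∀ᵐ ω ∂μ, ∀ i, (μ[fun ω => (WithLp.toLp p fun i => f i n ω :
        PiLp p fun _ : Fin N => ℝ) | ℱ m]) ω i = f i m ω := by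
      refine ae_all_iff.2 fun i => ?_
      filter_upwards [(PiLp.proj (𝕜 := ℝ) p (fun _ : Fin N => ℝ) i).comp_condExp_comm (m := ℱ m)
        (hint n), (hf i).1.2 m n hmn] with ω h1 h2
      exact h1.trans h2
    filter_upwards [h] with ω hω
    ext i
    exact hω i
  · filter_upwards [ae_all_iff.2 fun i => (hf i).2] with ω hω
    ext i
    exact hω i

/-- In the exponent of the sequence space, the vector-valued inequality decouples into scalar
inequalities, and Chebyshev's inequality gives a weak-type bound. -/
theorem weakTypeBound_coordFunctional [IsProbabilityMeasure μ] {N : ℕ} {p : ℝ≥0∞} [Fact (1 ≤ p)]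
    (hp : p ≠ ∞) {C : ℝ≥0}
    (hC : ∀ f : ℕ → Ω → ℝ, IsMartingaleFromZero f ℱ μ →
      eLpNorm (maximalFn f) (ENNReal.ofReal p.toReal) μ ≤
        C * eLpNorm (squareFn f) (ENNReal.ofReal p.toReal) μ) :
    WeakTypeBound (X := PiLp p fun _ : Fin N => ℝ) (pathOperator (coordFunctional p runningMax))
      (pathOperator (coordFunctional p runningSquare)) ℱ μ p.toReal (C ^ p.toReal) := by
  intro f hf t ht
  have hr : 0 < p.toReal := by linarith [one_le_toReal hp]
  set r := p.toReal with hrdef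
  have hpow : ∀ {Φ : (ℕ → ℝ) → ℕ → ℝ≥0}, IsPathFunctional Φ → ∀ ω,
      terminal (pathOperator (coordFunctional p Φ) f) ω ^ r =
        ∑ i, terminal (pathOperator Φ fun n ω => f n ω i) ω ^ r := fun hΦ ω => by
    rw [terminal_coordFunctional hp hΦ, ← ENNReal.rpow_mul, one_div_mul_cancel hr.ne',
      ENNReal.rpow_one]
  have hint : ∀ {Φ : (ℕ → ℝ) → ℕ → ℝ≥0}, IsPathFunctional Φ →
      ∫⁻ ω, terminal (pathOperator (coordFunctional p Φ) f) ω ^ r ∂μ =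
        ∑ i, eLpNorm (terminal (pathOperator Φ fun n ω => f n ω i)) (ENNReal.ofReal r) μ ^ r :=
    fun hΦ => by
    have hadm : IsAdmissible (X := ℝ) (pathOperator _) ℱ μ := hΦ.isAdmissible
    simp_rw [hpow hΦ]
    rw [lintegral_finsetSum _ fun i _ => (hadm.measurable_terminal (hf.coord i)).pow_const r]
    refine Finset.sum_congr rfl fun i _ => ?_
    rw [eLpNorm_ofReal_rpow hr]
  have hadm : IsAdmissible (X := PiLp p fun _ : Fin N => ℝ)
      (pathOperator (coordFunctional p runningMax)) ℱ μ :=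
    (isPathFunctional_coordFunctional hp isPathFunctional_runningMax).isAdmissible
  have hmarkov := mul_meas_ge_le_lintegral (μ := μ)
    ((hadm.measurable_terminal hf).pow_const r) (ENNReal.ofReal t ^ r)
  have hpow0 : ENNReal.ofReal t ^ r ≠ 0 := by
    simp [ENNReal.rpow_eq_zero_iff, ht]
  have hpowt : ENNReal.ofReal t ^ r ≠ ∞ := ENNReal.rpow_ne_top_of_nonneg hr.le (by simp)
  have e : ENNReal.ofReal (t ^ (-r)) = (ENNReal.ofReal t ^ r)⁻¹ := by
    rw [← ENNReal.rpow_neg, ENNReal.ofReal_rpow_of_pos ht]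
  rw [e, mul_comm (_ : ℝ≥0∞) _⁻¹, mul_assoc, ← ENNReal.div_eq_inv_mul,
    ENNReal.le_div_iff_mul_le (Or.inl hpow0) (Or.inl hpowt), mul_comm]
  calc ENNReal.ofReal t ^ r * μ {ω | ENNReal.ofReal t <
        terminal (pathOperator (coordFunctional p runningMax) f) ω}
      ≤ ∫⁻ ω, terminal (pathOperator (coordFunctional p runningMax) f) ω ^ r ∂μ := by
        refine (mul_le_mul_right (measure_mono fun ω hω => ?_) _).trans hmarkov
        exact ENNReal.rpow_le_rpow (le_of_lt hω) hr.le
    _ = ∑ i, eLpNorm (maximalFn fun n ω => f n ω i) (ENNReal.ofReal r) μ ^ r := by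
        rw [hint isPathFunctional_runningMax]
        simp only [terminal_runningMax]
    _ ≤ ∑ i, (C * eLpNorm (squareFn fun n ω => f n ω i) (ENNReal.ofReal r) μ) ^ r :=
        Finset.sum_le_sum fun i _ => ENNReal.rpow_le_rpow (hC _ (hf.coord i)) hr.le
    _ = (C ^ r : ℝ≥0) * eLpNorm (terminal (pathOperator (coordFunctional p runningSquare) f))
          (ENNReal.ofReal r) μ ^ r := by
        rw [eLpNorm_ofReal_rpow hr, hint isPathFunctional_runningSquare, Finset.mul_sum]
        refine Finset.sum_congr rfl fun i _ => ?_
        rw [ENNReal.mul_rpow_of_nonneg _ _ hr.le, ENNReal.coe_rpow_of_nonneg _ hr.le,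
          terminal_runningSquare]

/-- The vector-valued inequality for finitely many martingales, with a constant that does not depend
on their number. -/
theorem exists_eLpNorm_sum_maximalFn_le {q r : ℝ} (hq : 1 ≤ q) (hr : 1 ≤ r) :
    ∃ C : ℝ≥0, ∀ (Ω : Type*) (m0 : MeasurableSpace Ω) (μ : Measure Ω)
      [IsProbabilityMeasure μ] (ℱ : Filtration ℕ m0) (N : ℕ) (f : Fin N → ℕ → Ω → ℝ),
      (∀ i, IsMartingaleFromZero (f i) ℱ μ) →
        eLpNorm (fun ω => (∑ i, maximalFn (f i) ω ^ r) ^ (1 / r)) (ENNReal.ofReal q) μ ≤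
          C * eLpNorm (fun ω => (∑ i, squareFn (f i) ω ^ r) ^ (1 / r)) (ENNReal.ofReal q) μ := by
  obtain ⟨C₁, hC₁⟩ := exists_eLpNorm_maximalFn_le_squareFn hr
  have hr0 : 0 < r := by linarith
  obtain ⟨C, hC⟩ := exists_eLpNorm_terminal_le (C₁ ^ r) hq hr0
  refine ⟨2 * C, fun Ω m0 μ _ ℱ N f hf => ?_⟩
  set p := ENNReal.ofReal r with hp
  have hpt : p ≠ ∞ := ENNReal.ofReal_ne_top
  have hpr : p.toReal = r := ENNReal.toReal_ofReal hr0.le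
  have : Fact (1 ≤ p) := ⟨by simpa [hp] using hr⟩
  have hM := isPathFunctional_coordFunctional (N := N) hpt
    (isPathFunctional_runningMax (X := ℝ))
  have hS := isPathFunctional_coordFunctional (N := N) hpt
    (isPathFunctional_runningSquare (X := ℝ))
  have hweak := weakTypeBound_coordFunctional (μ := μ) (ℱ := ℱ) (N := N) hpt
    (by rw [hpr]; exact hC₁ Ω m0 μ ℱ)
  rw [hpr] at hweak
  set F : ℕ → Ω → PiLp p fun _ : Fin N => ℝ := fun n ω => WithLp.toLp p fun i => f i n ω with hF
  have hFm : IsMartingaleFromZero F ℱ μ := isMartingaleFromZero_toLp p hf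
  have h := hC Ω _ m0 μ ℱ _ _ hM.isAdmissible hS.isAdmissible hS.isEven hweak F hFm
  have eM : terminal (pathOperator (coordFunctional p runningMax) F) =
      fun ω => (∑ i, maximalFn (f i) ω ^ r) ^ (1 / r) := by
    ext ω
    rw [terminal_coordFunctional hpt isPathFunctional_runningMax, hpr]
    simp only [terminal_runningMax]
    rfl
  have eS : terminal (pathOperator (coordFunctional p runningSquare) F) =
      fun ω => (∑ i, squareFn (f i) ω ^ r) ^ (1 / r) := by
    ext ω
    rw [terminal_coordFunctional hpt isPathFunctional_runningSquare, hpr]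
    simp only [terminal_runningSquare]
    rfl
  have hd : eLpNorm (maximalFn (d F)) (ENNReal.ofReal q) μ ≤
      eLpNorm (terminal (pathOperator (coordFunctional p runningSquare) F))
        (ENNReal.ofReal q) μ :=
    eLpNorm_mono_enorm fun ω => maximalFn_d_le_terminal
      (nnnorm_sub_le_coordFunctional hpt nnnorm_sub_le_runningSquare) F ω
  rw [← eM, ← eS]
  refine (h.trans (mul_le_mul_right (add_le_add le_rfl hd) _)).trans (le_of_eq ?_)
  push_cast
  ring

theorem lr_eq_iSup {r : ℝ} (hr : 0 < r) (a : ℕ → ℝ≥0∞) :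
    lr r a = ⨆ N : ℕ, (∑ i : Fin N, a i ^ r) ^ (1 / r) := by
  rw [lr, ENNReal.tsum_eq_iSup_nat, ← ENNReal.orderIsoRpow_apply _ (one_div_pos.2 hr),
    OrderIso.map_iSup]
  refine iSup_congr fun N => ?_
  rw [ENNReal.orderIsoRpow_apply, Finset.sum_range]

theorem measurable_maximalFn {f : ℕ → Ω → ℝ} (hf : IsMartingaleFromZero f ℱ μ) :
    Measurable (maximalFn f) :=
  Measurable.iSup fun n => ((hf.1.1 n).mono (ℱ.le n)).enorm

/-- The vector-valued Burkholder-Davis-Gundy inequality (one half), by monotone convergence. -/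
theorem exists_eLpNorm_lr_maximalFn_le {q r : ℝ} (hq : 1 ≤ q) (hr : 1 ≤ r) :
    ∃ C : ℝ≥0, ∀ (Ω : Type*) (m0 : MeasurableSpace Ω) (μ : Measure Ω)
      [IsProbabilityMeasure μ] (ℱ : Filtration ℕ m0) (f : ℕ → ℕ → Ω → ℝ),
      (∀ k, IsMartingaleFromZero (f k) ℱ μ) →
        eLpNorm (fun ω => lr r fun k => maximalFn (f k) ω) (ENNReal.ofReal q) μ ≤
          C * eLpNorm (fun ω => lr r fun k => squareFn (f k) ω) (ENNReal.ofReal q) μ := by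
  obtain ⟨C, hC⟩ := exists_eLpNorm_sum_maximalFn_le hq hr
  have hq0 : 0 < q := by linarith
  have hr0 : 0 < r := by linarith
  have hr0' : 0 ≤ 1 / r := one_div_nonneg.2 hr0.le
  refine ⟨C, fun Ω m0 μ _ ℱ f hf => ?_⟩
  have hsup : eLpNorm (fun ω => lr r fun k => maximalFn (f k) ω) (ENNReal.ofReal q) μ =
      ⨆ N : ℕ, eLpNorm (fun ω => (∑ i : Fin N, maximalFn (f i) ω ^ r) ^ (1 / r))
        (ENNReal.ofReal q) μ := by
    simp_rw [eLpNorm_ofReal_eq hq0, lr_eq_iSup hr0, ← ENNReal.orderIsoRpow_apply q hq0,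
      OrderIso.map_iSup]
    rw [lintegral_iSup, ← ENNReal.orderIsoRpow_apply _ (one_div_pos.2 hq0), OrderIso.map_iSup]
    · rfl
    · intro N
      change Measurable fun ω => ((∑ i : Fin N, maximalFn (f i) ω ^ r) ^ (1 / r)) ^ q
      exact ((Finset.measurable_sum Finset.univ fun (i : Fin N) _ =>
        (measurable_maximalFn (hf i)).pow_const r).pow_const (1 / r)).pow_const q
    · intro M N hMN ω
      refine ENNReal.rpow_le_rpow (ENNReal.rpow_le_rpow ?_ hr0') hq0.le
      rw [← Finset.sum_range fun i => maximalFn (f i) ω ^ r,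
        ← Finset.sum_range fun i => maximalFn (f i) ω ^ r]
      exact Finset.sum_le_sum_of_subset (Finset.range_subset_range.2 hMN)
  rw [hsup]
  refine iSup_le fun N => (hC Ω m0 μ ℱ N (fun i => f i) fun i => hf i).trans
    (mul_le_mul_right (eLpNorm_mono_enorm fun ω => ?_) _)
  simp only [enorm_eq_self]
  rw [lr_eq_iSup hr0]
  exact le_iSup (fun N : ℕ => (∑ i : Fin N, squareFn (f i) ω ^ r) ^ (1 / r)) N

end Vector

end MartingaleBDG

theorem mainTheorem5 :
    -- the extrapolation lemma
    (∀ (q r : ℝ) (K : ℝ≥0), 1 ≤ q → 1 < r →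
      ∃ C : ℝ≥0, ∀ (Ω X : Type*) (m0 : MeasurableSpace Ω) (μ : Measure Ω)
        [IsProbabilityMeasure μ] (ℱ : Filtration ℕ m0)
        [NormedAddCommGroup X] [NormedSpace ℝ X] [CompleteSpace X]
        (T U : (ℕ → Ω → X) → ℕ → Ω → ℝ≥0),
        MartingaleBDG.IsAdmissible T ℱ μ →
        MartingaleBDG.IsAdmissible U ℱ μ →
        MartingaleBDG.IsEven U ℱ μ →
        MartingaleBDG.WeakTypeBound T U ℱ μ r K →
        ∀ f : ℕ → Ω → X, MartingaleBDG.IsMartingaleFromZero f ℱ μ →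
          eLpNorm (MartingaleBDG.terminal (T f)) (ENNReal.ofReal q) μ ≤
            C * (eLpNorm (MartingaleBDG.terminal (U f)) (ENNReal.ofReal q) μ +
              eLpNorm (MartingaleBDG.maximalFn (MartingaleBDG.d f)) (ENNReal.ofReal q) μ)) ∧
    -- the vector-valued Burkholder-Davis-Gundy inequality
    (∀ q r : ℝ, 1 ≤ q → 1 ≤ r →
      ∃ C : ℝ≥0, ∀ (Ω : Type*) (m0 : MeasurableSpace Ω) (μ : Measure Ω)
        [IsProbabilityMeasure μ] (ℱ : Filtration ℕ m0) (f : ℕ → ℕ → Ω → ℝ),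
        (∀ k, MartingaleBDG.IsMartingaleFromZero (f k) ℱ μ) →
          eLpNorm (fun ω => MartingaleBDG.lr r fun k => MartingaleBDG.maximalFn (f k) ω)
              (ENNReal.ofReal q) μ ≤
            C * eLpNorm (fun ω => MartingaleBDG.lr r fun k => MartingaleBDG.squareFn (f k) ω)
              (ENNReal.ofReal q) μ) := by
  refine ⟨fun q r K hq hr => ?_, fun q r hq hr => ?_⟩
  · exact MartingaleBDG.exists_eLpNorm_terminal_le K hq (by linarith)
  · exact MartingaleBDG.exists_eLpNorm_lr_maximalFn_le hq hr
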